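/- Let $I:\mathbb{R}\to[0,\infty]$ be a good convex rate function (convex, lower semicontinuous, with compact sublevel sets $\{I\le a\}$, $a<\infty$). Suppose that $I(-\delta)=0$ for some $\delta>0$ and that $I(y)>0$ for all $y>0$. Let $\Lambda(\theta)=\sup_y(\theta y-I(y))$ be the dual cumulant generating function, and put $\theta^{\uparrow}=\sup\{\theta>0:\Lambda(\theta)<\infty\}$ and $\theta^{\downarrow}=\sup\{\theta>0:\Lambda(-\theta)<\infty\}$, both in $(0,\infty]$. Let $L^+[0,1]$ be the set of non-negative càdlàg functions of finite variation on $[0,1]$. For $\psi\in L^+[0,1]$ let $d\psi$ be the signed measure on $[0,1]$ with $d\psi([0,t])=\psi(t)$ for all $t\in[0,1]$ (so that it has an atom of mass $\psi(0)$ at $0$). Let $\dot\psi^{(a)}$ be the density of its absolutely continuous part with respect to Lebesgue measure, and let $\psi^{\uparrow}(1)$ and $\psi^{\downarrow}(1)$ be the total masses of the positive and the negative part of its singular part. Set $$J(\psi)=\int_0^1\Bigl(I(\dot\psi^{(a)}(s))1_{\{\psi(s)>0\}}+\inf_{y\le 0}I(y)\,1_{\{\psi(s)=0\}}\Bigr)ds+\theta^{\downarrow}\psi^{\downarrow}(1)+\theta^{\uparrow}\psi^{\uparrow}(1)\in[0,\infty],$$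 with $\infty\cdot 0=0$. Then for every $z>0$ the problem of minimizing $J(\psi)$ over all $\psi\in L^+[0,1]$ with $\int_0^1\psi(s)\,ds=z$ has an optimal solution. Moreover, for every optimal solution $\psi^*$ with $J(\psi^*)<\infty$ there exist $0\le T_0<T_1\le 1$ such that (i) $\psi^*(t)>0$ for $t\in(T_0,T_1)$, and $\psi^*(t)=0$ for $t\in[0,1]\setminus[T_0,T_1]$; (ii) $\psi^*$ is concave on $[T_0,T_1]$; (iii) $\psi^*$, as a function on $[0,1]$, is continuous at every point of $(T_0,T_1]$ (a jump at $T_0$ is possible). -/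

import Mathlib

open MeasureTheory Set Filter Topology
open scoped ENNReal NNReal

namespace RRW

/-! ### Rate functions -/

/-- A good convex rate function on `ℝ`: a lower semicontinuous convex function with values in
`[0, ∞]` whose sublevel sets at finite levels are compact. Convexity is the usual inequality
`I (a x + b y) ≤ a I x + b I y` for `a, b ≥ 0` with `a + b = 1`, with values in `[0, ∞]`. -/
structure IsGoodConvexRate (I : ℝ → ℝ≥0∞) : Prop where
  lowerSemicontinuous : LowerSemicontinuous I
  isCompact_sublevel : ∀ a : ℝ≥0, IsCompact {x | I x ≤ a}
  convex : ConvexOn ℝ≥0 univ I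

/-- The Legendre transform `Λ θ = sup_y (θ y - I y)`, with values in `[-∞, ∞]`; it is the
cumulant generating function that `I` is dual to. -/
noncomputable def cgf (I : ℝ → ℝ≥0∞) (θ : ℝ) : EReal :=
  ⨆ y : ℝ, (((θ * y : ℝ) : EReal) - (I y : EReal))

/-- `θ↑ = sup {θ > 0 : Λ θ < ∞}`. -/
noncomputable def thetaUp (I : ℝ → ℝ≥0∞) : ℝ≥0∞ :=
  ⨆ (θ : ℝ) (_ : 0 < θ ∧ cgf I θ < ⊤), ENNReal.ofReal θ

/-- `θ↓ = sup {θ > 0 : Λ (-θ) < ∞}`. -/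
noncomputable def thetaDown (I : ℝ → ℝ≥0∞) : ℝ≥0∞ :=
  ⨆ (θ : ℝ) (_ : 0 < θ ∧ cgf I (-θ) < ⊤), ENNReal.ofReal θ

/-! ### Paths -/

/-- The set `L⁺[0,1]` of non-negative càdlàg functions of finite variation on `[0,1]`.
Only the values of `ψ` on `[0,1]` matter. -/
structure IsPath (ψ : ℝ → ℝ) : Prop where
  nonneg : ∀ t ∈ Icc (0 : ℝ) 1, 0 ≤ ψ t
  right_continuous : ∀ t ∈ Ico (0 : ℝ) 1, ContinuousWithinAt ψ (Ici t) t
  left_limit : ∀ t ∈ Ioc (0 : ℝ) 1, ∃ l : ℝ, Tendsto ψ (𝓝[<] t) (𝓝 l)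
  finite_variation : BoundedVariationOn ψ (Icc 0 1)

/-- The extension of `ψ` from `[0,1]` to the real line by `0` on the left and by `ψ 1` on the
right. -/
noncomputable def extend (ψ : ℝ → ℝ) (t : ℝ) : ℝ :=
  if t < 0 then 0 else ψ (min t 1)

theorem IsPath.boundedVariationOn_extend {ψ : ℝ → ℝ} (h : IsPath ψ) :
    BoundedVariationOn (extend ψ) univ := by
  have hc : eVariationOn (extend ψ) (Ici 0) ≤ eVariationOn ψ (Icc 0 1) := by
    have e : EqOn (extend ψ) (ψ ∘ fun t => min t 1) (Ici 0) := by
      intro t ht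
      simp only [extend, Function.comp, if_neg (not_lt.2 (mem_Ici.1 ht))]
    rw [eVariationOn.congr e]
    refine eVariationOn.comp_le_of_monotoneOn ψ _ ?_ ?_
    · intro a _ b _ hab
      exact min_le_min_right 1 hab
    · intro t ht
      exact ⟨le_min ht zero_le_one, min_le_right _ _⟩
  have h0 : 0 ≤ ψ 0 := h.nonneg 0 (by simp)
  have hm : MonotoneOn (extend ψ) (Iic 0) := by
    intro a ha b hb hab
    rcases (mem_Iic.1 hb).lt_or_eq with hb' | rfl
    · simp [extend, hb', hab.trans_lt hb']
    · rcases (mem_Iic.1 ha).lt_or_eq with ha' | rfl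
      · simp [extend, ha', h0]
      · exact le_rfl
  have hl : BoundedVariationOn (extend ψ) (Iic 0) := by
    refine hm.boundedVariationOn (C := ψ 0) fun x hx => ?_
    rcases (mem_Iic.1 hx).lt_or_eq with hx' | rfl
    · simp [extend, hx', h0]
    · simp [extend, abs_of_nonneg h0]
  rw [BoundedVariationOn, ← Iic_union_Ici (a := (0 : ℝ)),
    eVariationOn.union _ (isGreatest_Iic) (isLeast_Ici)]
  exact ENNReal.add_ne_top.2 ⟨hl, (hc.trans_lt h.finite_variation.lt_top).ne⟩

open scoped Classical in
/-- The signed measure `dψ` on `[0,1]` of a path `ψ`, determined by `dψ [0,t] = ψ t` for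
`t ∈ [0,1]`; in particular it has an atom of mass `ψ 0` at `0`. -/
noncomputable def pathMeasure (ψ : ℝ → ℝ) : SignedMeasure ℝ :=
  if h : BoundedVariationOn (extend ψ) univ then h.vectorMeasure else 0

theorem IsPath.pathMeasure_Icc {ψ : ℝ → ℝ} (h : IsPath ψ) {t : ℝ} (ht : t ∈ Icc (0 : ℝ) 1) :
    pathMeasure ψ (Icc 0 t) = ψ t := by
  have hr : (extend ψ).rightLim t = extend ψ t := by
    apply ContinuousWithinAt.rightLim_eq
    rcases ht.2.lt_or_eq with h1 | rfl
    · refine (h.right_continuous t ⟨ht.1, h1⟩).congr_of_eventuallyEq ?_ ?_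
      · have : ∀ᶠ s in 𝓝[≥] t, s ∈ Ico t 1 := Ico_mem_nhdsGE h1
        filter_upwards [this] with s hs
        simp [extend, not_lt.2 (ht.1.trans hs.1), hs.2.le]
      · simp [extend, not_lt.2 ht.1, h1.le]
    · refine continuousWithinAt_const (b := ψ 1) |>.congr ?_ ?_
      · intro s hs
        simp [extend, not_lt.2 (zero_le_one.trans (mem_Ici.1 hs)), mem_Ici.1 hs]
      · simp [extend]
  have hl : (extend ψ).leftLim 0 = 0 := by
    apply leftLim_eq_of_tendsto
    refine tendsto_const_nhds.congr' ?_
    filter_upwards [self_mem_nhdsWithin] with s hs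
    simp [extend, mem_Iio.1 hs]
  rw [pathMeasure, dif_pos h.boundedVariationOn_extend,
    BoundedVariationOn.vectorMeasure_Icc _ ht.1, hr, hl]
  simp [extend, not_lt.2 ht.1, ht.2]

/-- The density `ψ̇⁽ᵃ⁾` of the absolutely continuous part of `dψ`. -/
noncomputable def acDeriv (ψ : ℝ → ℝ) : ℝ → ℝ :=
  (pathMeasure ψ).rnDeriv volume

/-- `ψ↑(1)`: the total mass of the positive part of the singular part of `dψ`. -/
noncomputable def singUp (ψ : ℝ → ℝ) : ℝ≥0∞ :=
  ((pathMeasure ψ).singularPart volume).toJordanDecomposition.posPart univ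

/-- `ψ↓(1)`: the total mass of the negative part of the singular part of `dψ`. -/
noncomputable def singDown (ψ : ℝ → ℝ) : ℝ≥0∞ :=
  ((pathMeasure ψ).singularPart volume).toJordanDecomposition.negPart univ

/-! ### The variational problem -/

/-- The objective function `J`. The conventions `∞ * 0 = 0 * ∞ = 0` of `ℝ≥0∞` are those wanted
when `θ↑ = ∞` or `θ↓ = ∞`. -/
noncomputable def J (I : ℝ → ℝ≥0∞) (ψ : ℝ → ℝ) : ℝ≥0∞ :=
  (∫⁻ s in Icc (0 : ℝ) 1, if 0 < ψ s then I (acDeriv ψ s) else ⨅ (y : ℝ) (_ : y ≤ 0), I y)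
    + thetaDown I * singDown ψ + thetaUp I * singUp ψ

/-- The paths over which `J` is minimized. -/
def Feasible (z : ℝ) (ψ : ℝ → ℝ) : Prop :=
  IsPath ψ ∧ ∫ s in (0 : ℝ)..1, ψ s = z

/-- `ψ` is an optimal solution: it minimizes `J` over the feasible paths. -/
def IsOptimal (I : ℝ → ℝ≥0∞) (z : ℝ) (ψ : ℝ → ℝ) : Prop :=
  Feasible z ψ ∧ ∀ φ, Feasible z φ → J I ψ ≤ J I φ

end RRW

namespace RRW

/-! ### Rate functions -/

/-! The cost of a path depends on the slopes it takes while positive, not on their order, so using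
the largest slopes first can only help. Let `P = busy ψ`, of measure `ℓ`, and let `τ = clock P`. A
nonnegative function has derivative zero where it vanishes, so the absolutely continuous part of `ψ`
comes from `P` alone (`IsPath.acDeriv_ae_eq_zero`). Put the whole upward singular mass `a` at the
start, drop the downward one, rearrange the density on `P` into an antitone slope `y`, and raise `y`
to at least the free slope `-δ`. The concave profile `Φ u = a + ∫₀ᵘ y` costs no more
(`IsPath.exists_profile`) and satisfies `ψ ≤ Φ ∘ τ`. As `τ` carries Lebesgue measure on `P` to
Lebesgue measure on `[0,ℓ]`, the area under `Φ` is at least `z` (`IsPath.integral_le_profileArea`).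

Conversely, a profile becomes a path by waiting at zero until time `1 - ℓ`
(`IsProfile.exists_path`). Shrinking time and space by `c ≤ 1` multiplies area by `c²` and cost by
`c`, so a profile of area at least `z` gives a feasible path that is no dearer, and strictly cheaper
if the area exceeds `z` and the cost is positive and finite. It remains to minimize over profiles of
area at least `z`.

Existence: `I` grows at least linearly at `+∞`, so initial values and positive slope mass stay
bounded along a minimizing sequence, and Helly's theorem gives slopes converging off a countable
set. Slope mass may escape to time `0` and become an initial jump. The affine bounds `θ x ≤ I x +
L`, for all `θ > 0` with `Λ θ < ∞`, show that the price `θ↑` of this jump does not exceed the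
limiting cost (`ProfilesTendsto.cost_le`).

Structure: an optimal `ψ` of finite cost must tie with its own profile. Equal areas give `ψ = Φ ∘ τ`
almost everywhere on `P`, and equal costs exclude downward singular mass because `θ↓ > 0`. Since a
concave `Φ` stays positive inside `(0,ℓ)`, the path makes a single excursion, a translate of `Φ`
(`IsPath.structure_of_eq`). -/

theorem IsGoodConvexRate.measurable {I : ℝ → ℝ≥0∞} (hI : IsGoodConvexRate I) : Measurable I :=
  hI.lowerSemicontinuous.measurable

/-- `q` is the convex combination of `p` and the far point with weight `t⁻¹` on the latter. -/
theorem IsGoodConvexRate.mul_le {I : ℝ → ℝ≥0∞} (hI : IsGoodConvexRate I) {p q t : ℝ}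
    (hp : I p = 0) (ht : 1 ≤ t) : ENNReal.ofReal t * I q ≤ I (p + t * (q - p)) := by
  have ht0 : 0 < t := by linarith
  have hb : t⁻¹ ≤ 1 := inv_le_one_of_one_le₀ ht
  obtain ⟨-, hc⟩ := hI.convex
  obtain ⟨a, ha⟩ : ∃ a : ℝ≥0, (a : ℝ) = 1 - t⁻¹ :=
    ⟨(1 - t⁻¹).toNNReal, Real.coe_toNNReal _ (by linarith)⟩
  obtain ⟨b, hb'⟩ : ∃ b : ℝ≥0, (b : ℝ) = t⁻¹ :=
    ⟨t⁻¹.toNNReal, Real.coe_toNNReal _ (by positivity)⟩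
  have key := hc (mem_univ p) (mem_univ (p + t * (q - p))) (a := a) (b := b) zero_le zero_le
    (by ext; push_cast; rw [ha, hb']; ring)
  have e : a • p + b • (p + t * (q - p)) = q := by
    rw [NNReal.smul_def, NNReal.smul_def, ha, hb']
    simp only [smul_eq_mul]
    field_simp
    ring
  rw [e, hp, smul_zero, zero_add] at key
  have e2 : b • I (p + t * (q - p)) = ENNReal.ofReal t⁻¹ * I (p + t * (q - p)) := by
    rw [ENNReal.smul_def, smul_eq_mul, ← hb', ENNReal.ofReal_coe_nnreal]
  rw [e2] at key
  calc ENNReal.ofReal t * I q ≤ ENNReal.ofReal t * (ENNReal.ofReal t⁻¹ * I (p + t * (q - p))) := by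
        gcongr
    _ = I (p + t * (q - p)) := by
        rw [← mul_assoc, ← ENNReal.ofReal_mul ht0.le, mul_inv_cancel₀ ht0.ne', ENNReal.ofReal_one,
          one_mul]

theorem IsGoodConvexRate.exists_linear_le {I : ℝ → ℝ≥0∞} (hI : IsGoodConvexRate I) {p q : ℝ}
    (hp : I p = 0) (hq : 0 < I q) :
    ∃ c : ℝ, 0 < c ∧ ∀ t : ℝ, 1 ≤ t → ENNReal.ofReal (c * t) ≤ I (p + t * (q - p)) := by
  -- `I q` may be infinite; capping it at `1` keeps the constant real.
  have h1 : min (I q) 1 ≠ ⊤ := ((min_le_right _ _).trans_lt ENNReal.one_lt_top).ne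
  refine ⟨(min (I q) 1).toReal, ENNReal.toReal_pos (by simp [hq.ne']) h1, fun t ht => ?_⟩
  rw [mul_comm, ENNReal.ofReal_mul (by linarith), ENNReal.ofReal_toReal h1]
  exact (mul_le_mul_right (min_le_left _ _) _).trans (hI.mul_le hp ht)

/-- Finiteness of `Λ θ` is used as an additive affine bound, which avoids subtracting infinities.
Passing to the positive part of `θ * y` is harmless because the right side is nonnegative. -/
theorem cgf_lt_top_of_le {I : ℝ → ℝ≥0∞} {θ L : ℝ} (hL : 0 ≤ L)
    (h : ∀ y, ENNReal.ofReal (θ * y) ≤ I y + ENNReal.ofReal L) : cgf I θ < ⊤ := by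
  refine lt_of_le_of_lt (iSup_le fun y => ?_) (EReal.coe_lt_top L)
  rcases eq_or_ne (I y) ⊤ with hy | hy
  · simp [hy]
  · have := h y
    lift I y to ℝ≥0 using hy with v hv
    rw [← ENNReal.ofReal_coe_nnreal, ← ENNReal.ofReal_add v.coe_nonneg hL,
      ENNReal.ofReal_le_ofReal_iff (by positivity)] at this
    have e : (((v : ℝ≥0∞) : EReal)) = ((v : ℝ) : EReal) := rfl
    rw [e, ← EReal.coe_sub, EReal.coe_le_coe_iff]
    linarith

theorem exists_le_of_cgf_lt_top {I : ℝ → ℝ≥0∞} {θ : ℝ} (h : cgf I θ < ⊤) :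
    ∃ L : ℝ, 0 ≤ L ∧ ∀ y, ENNReal.ofReal (θ * y) ≤ I y + ENNReal.ofReal L := by
  obtain ⟨L, hL, -⟩ := EReal.lt_iff_exists_real_btwn.1 h
  refine ⟨max L 0, le_max_right _ _, fun y => ?_⟩
  rcases eq_or_ne (I y) ⊤ with hy | hy
  · simp [hy]
  · have := (le_iSup (fun y : ℝ => (((θ * y : ℝ) : EReal) - (I y : EReal))) y).trans hL.le
    lift I y to ℝ≥0 using hy with v hv
    have e : (((v : ℝ≥0∞) : EReal)) = ((v : ℝ) : EReal) := rfl
    rw [e, ← EReal.coe_sub, EReal.coe_le_coe_iff] at this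
    rw [← ENNReal.ofReal_coe_nnreal, ← ENNReal.ofReal_add v.coe_nonneg (le_max_right _ _)]
    apply ENNReal.ofReal_le_ofReal
    have := le_max_left L 0
    linarith

theorem IsGoodConvexRate.exists_cgf_lt_top {I : ℝ → ℝ≥0∞} (hI : IsGoodConvexRate I) {δ : ℝ}
    (hδ : 0 < δ) (hIδ : I (-δ) = 0) (hpos : ∀ y : ℝ, 0 < y → 0 < I y) :
    ∃ θ : ℝ, 0 < θ ∧ cgf I θ < ⊤ := by
  obtain ⟨c, hc, h⟩ := hI.exists_linear_le hIδ (hpos δ hδ)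
  -- On the ray from `-δ` through `δ` the parameter of `y` is `(y + δ) / (2 * δ)`, whence the slope
  -- `c / (2 * δ)`. For `y < δ` the constant `c` suffices.
  refine ⟨c / (2 * δ), by positivity, cgf_lt_top_of_le hc.le fun y => ?_⟩
  rcases le_or_gt δ y with hy | hy
  · have := h ((y + δ) / (2 * δ)) (by rw [le_div_iff₀ (by positivity)]; linarith)
    have e : -δ + (y + δ) / (2 * δ) * (δ - -δ) = y := by field_simp; ring
    rw [e] at this
    refine le_trans (le_trans (ENNReal.ofReal_le_ofReal ?_) this) le_self_add
    rw [div_mul_eq_mul_div, ← mul_div_assoc]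
    gcongr
    linarith
  · refine le_trans (ENNReal.ofReal_le_ofReal ?_) le_add_self
    rw [div_mul_eq_mul_div, div_le_iff₀ (by positivity)]
    nlinarith

theorem IsGoodConvexRate.exists_cgf_neg_lt_top {I : ℝ → ℝ≥0∞} (hI : IsGoodConvexRate I) {δ : ℝ}
    (hδ : 0 < δ) (hIδ : I (-δ) = 0) : ∃ θ : ℝ, 0 < θ ∧ cgf I (-θ) < ⊤ := by
  obtain ⟨M, hM⟩ := (hI.isCompact_sublevel 0).bddBelow
  -- `-r` lies to the left of `-δ` and of the whole compact zero set of `I`.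
  set r := max (δ + 1) (1 - M) with hr
  have hr1 : δ + 1 ≤ r := le_max_left _ _
  have hr2 : 1 - M ≤ r := le_max_right _ _
  have hq : 0 < I (-r) := by
    by_contra! h0
    have : M ≤ -r := hM (by simpa using h0)
    linarith
  obtain ⟨c, hc, h⟩ := hI.exists_linear_le hIδ hq
  have hd : 0 < r - δ := by linarith
  have hr0 : 0 < r := by linarith
  refine ⟨c / r, by positivity, cgf_lt_top_of_le hc.le fun y => ?_⟩
  rcases le_or_gt y (-r) with hy | hy
  · have := h ((-y - δ) / (r - δ)) (by rw [le_div_iff₀ hd]; linarith)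
    have e : -δ + (-y - δ) / (r - δ) * (-r - -δ) = y := by field_simp; ring
    rw [e] at this
    refine le_trans (le_trans (ENNReal.ofReal_le_ofReal ?_) this) le_self_add
    have e2 : -(c / r) * y = c * (-y / r) := by ring
    rw [e2]
    refine mul_le_mul_of_nonneg_left ?_ hc.le
    rw [div_le_div_iff₀ hr0 hd]
    nlinarith
  · refine le_trans (ENNReal.ofReal_le_ofReal ?_) le_add_self
    rw [neg_mul, div_mul_eq_mul_div, ← neg_div, div_le_iff₀ hr0]
    nlinarith

theorem thetaUp_pos {I : ℝ → ℝ≥0∞} (h : ∃ θ : ℝ, 0 < θ ∧ cgf I θ < ⊤) : 0 < thetaUp I := by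
  obtain ⟨θ, h0, h1⟩ := h
  exact (ENNReal.ofReal_pos.2 h0).trans_le
    (le_iSup₂ (f := fun θ (_ : 0 < θ ∧ cgf I θ < ⊤) => ENNReal.ofReal θ) θ ⟨h0, h1⟩)

theorem thetaDown_pos {I : ℝ → ℝ≥0∞} (h : ∃ θ : ℝ, 0 < θ ∧ cgf I (-θ) < ⊤) :
    0 < thetaDown I := by
  obtain ⟨θ, h0, h1⟩ := h
  exact (ENNReal.ofReal_pos.2 h0).trans_le
    (le_iSup₂ (f := fun θ (_ : 0 < θ ∧ cgf I (-θ) < ⊤) => ENNReal.ofReal θ) θ ⟨h0, h1⟩)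

theorem iInf_nonpos_eq_zero {I : ℝ → ℝ≥0∞} {δ : ℝ} (hδ : 0 < δ) (hIδ : I (-δ) = 0) :
    ⨅ (y : ℝ) (_ : y ≤ 0), I y = 0 :=
  le_antisymm ((iInf₂_le (-δ) (by linarith)).trans hIδ.le) zero_le

theorem rate_max_le {I : ℝ → ℝ≥0∞} {δ : ℝ} (hIδ : I (-δ) = 0) (y : ℝ) :
    I (max y (-δ)) ≤ I y := by
  rcases le_total y (-δ) with h | h
  · simp [max_eq_right h, hIδ]
  · rw [max_eq_left h]

/-! ### The signed measure of a path -/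

theorem measurable_of_boundedVariationOn {f : ℝ → ℝ} (hf : BoundedVariationOn f univ) :
    Measurable f := by
  obtain ⟨p, q, hp, hq, rfl⟩ := hf.locallyBoundedVariationOn.exists_monotoneOn_sub_monotoneOn
  exact (monotoneOn_univ.1 hp).measurable.sub (monotoneOn_univ.1 hq).measurable

theorem extend_eq {ψ : ℝ → ℝ} {t : ℝ} (ht : t ∈ Icc (0 : ℝ) 1) : extend ψ t = ψ t := by
  simp [extend, not_lt.2 ht.1, ht.2]

theorem continuousWithinAt_measureReal_Iic (μ : Measure ℝ) [IsFiniteMeasure μ] (x : ℝ) :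
    ContinuousWithinAt (fun t => μ.real (Iic t)) (Ici x) x := by
  have hm : Monotone fun t => μ.real (Iic t) := fun a b hab =>
    measureReal_mono (Iic_subset_Iic.2 hab)
  have := tendsto_measure_iInter_atTop (μ := μ) (s := fun n : ℕ => Iic (x + 1 / ((n : ℝ) + 1)))
    (fun _ => measurableSet_Iic.nullMeasurableSet)
    (fun a b hab => Iic_subset_Iic.2 (by
      have : (a : ℝ) ≤ b := by exact_mod_cast hab
      gcongr)) ⟨0, measure_ne_top _ _⟩
  have e : ⋂ n : ℕ, Iic (x + 1 / ((n : ℝ) + 1)) = Iic x := by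
    ext y
    simp only [mem_iInter, mem_Iic]
    refine ⟨fun h => le_of_forall_pos_le_add fun ε hε => ?_, fun h n => h.trans ?_⟩
    · obtain ⟨n, hn⟩ := exists_nat_one_div_lt hε
      exact (h n).trans (by linarith)
    · have : 0 < 1 / ((n : ℝ) + 1) := by positivity
      linarith
  rw [e] at this
  have ht := (ENNReal.tendsto_toReal (measure_ne_top μ (Iic x))).comp this
  have hr := hm.tendsto_rightLim x
  have hseq : Tendsto (fun n : ℕ => x + 1 / ((n : ℝ) + 1)) atTop (𝓝[>] x) := by
    refine tendsto_nhdsWithin_iff.2 ⟨?_, Eventually.of_forall fun n => ?_⟩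
    · simpa using (tendsto_one_div_add_atTop_nhds_zero_nat (𝕜 := ℝ)).const_add x
    · have : 0 < 1 / ((n : ℝ) + 1) := by positivity
      simp only [mem_Ioi]
      linarith
  have hu := tendsto_nhds_unique (hr.comp hseq) ht
  rw [← continuousWithinAt_Ioi_iff_Ici]
  rw [hu] at hr
  exact hr

/-- `μ` is the Stieltjes measure of its own distribution function, so Lebesgue's differentiation
theorem applies. -/
theorem ae_hasDerivAt_measure_Iic (μ : Measure ℝ) [IsFiniteMeasure μ] :
    ∀ᵐ x, HasDerivAt (fun t => μ.real (Iic t)) (μ.rnDeriv volume x).toReal x := by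
  let F : StieltjesFunction ℝ :=
    { toFun := fun t => μ.real (Iic t)
      mono' := fun a b hab => measureReal_mono (Iic_subset_Iic.2 hab)
      right_continuous' := continuousWithinAt_measureReal_Iic μ }
  have hF : F.measure = μ := by
    refine Measure.ext_of_Ioc _ _ fun a b hab => ?_
    rw [F.measure_Ioc, show Ioc a b = Iic b \ Iic a by ext; simp [and_comm],
      measure_sdiff (Iic_subset_Iic.2 hab.le) measurableSet_Iic.nullMeasurableSet
        (measure_ne_top _ _)]
    change ENNReal.ofReal (μ.real (Iic b) - μ.real (Iic a)) = _
    rw [ENNReal.ofReal_sub _ measureReal_nonneg, ofReal_measureReal, ofReal_measureReal]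
  have := F.ae_hasDerivAt
  rw [hF] at this
  exact this

theorem signedMeasure_apply_eq (μ : SignedMeasure ℝ) {s : Set ℝ} (hs : MeasurableSet s) :
    μ s = μ.toJordanDecomposition.posPart.real s - μ.toJordanDecomposition.negPart.real s := by
  conv_lhs => rw [← μ.toSignedMeasure_toJordanDecomposition]
  rw [JordanDecomposition.toSignedMeasure, _root_.sub_apply,
    Measure.toSignedMeasure_apply_measurable hs, Measure.toSignedMeasure_apply_measurable hs]

theorem IsPath.apply_eq {ψ : ℝ → ℝ} (h : IsPath ψ) {t : ℝ} (ht : t ∈ Icc (0 : ℝ) 1) :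
    ψ t = ((pathMeasure ψ).singularPart volume).toJordanDecomposition.posPart.real (Icc 0 t)
      - ((pathMeasure ψ).singularPart volume).toJordanDecomposition.negPart.real (Icc 0 t)
      + ∫ s in Icc 0 t, acDeriv ψ s := by
  rw [← h.pathMeasure_Icc ht]
  conv_lhs =>
    rw [← SignedMeasure.singularPart_add_withDensity_rnDeriv_eq (s := pathMeasure ψ)
      (μ := volume)]
  rw [_root_.add_apply, signedMeasure_apply_eq _ measurableSet_Icc,
    withDensityᵥ_apply (SignedMeasure.integrable_rnDeriv _ _) measurableSet_Icc]
  rfl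

/-- A zero of `ψ` in `(0,1)` is a local minimum, so the derivative vanishes there whenever it
exists. -/
theorem IsPath.acDeriv_ae_eq_zero {ψ : ℝ → ℝ} (h : IsPath ψ) :
    ∀ᵐ s, s ∈ Icc (0 : ℝ) 1 → ψ s = 0 → acDeriv ψ s = 0 := by
  have h0 : ∀ᵐ s : ℝ, s ≠ 0 := by simp [ae_iff]
  have h1 : ∀ᵐ s : ℝ, s ≠ 1 := by simp [ae_iff]
  set j := (pathMeasure ψ).toJordanDecomposition with hj
  filter_upwards [ae_hasDerivAt_measure_Iic j.posPart, ae_hasDerivAt_measure_Iic j.negPart, h0, h1]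
    with s hp hn hs0 hs1 hs hψ
  have hs' : s ∈ Ioo (0 : ℝ) 1 := ⟨lt_of_le_of_ne hs.1 hs0.symm, lt_of_le_of_ne hs.2 hs1⟩
  have hd := hp.sub hn
  refine IsLocalMin.hasDerivAt_eq_zero (f := (fun t => j.posPart.real (Iic t)) -
    (fun t => j.negPart.real (Iic t))) ?_ hd
  -- The distribution function of `dψ` agrees with `ψ` on `(0,1)` up to an additive constant,
  -- irrelevant for derivatives.
  have key : ∀ t ∈ Ioo (0 : ℝ) 1, ((fun t => j.posPart.real (Iic t)) -
      (fun t => j.negPart.real (Iic t))) t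
      = ψ t + (pathMeasure ψ) (Iio 0) := by
    intro t ht
    have e : Iic t = Iio 0 ∪ Icc 0 t := (Iio_union_Icc_eq_Iic ht.1.le).symm
    rw [Pi.sub_apply, hj, ← signedMeasure_apply_eq _ measurableSet_Iic, e,
      VectorMeasure.of_union _ measurableSet_Iio measurableSet_Icc,
      h.pathMeasure_Icc ⟨ht.1.le, ht.2.le⟩, add_comm]
    exact disjoint_left.2 fun x hx hx' => absurd hx'.1 (not_le.2 hx)
  filter_upwards [isOpen_Ioo.mem_nhds hs'] with t ht
  rw [key t ht, key s hs', hψ]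
  have := h.nonneg t ⟨ht.1.le, ht.2.le⟩
  linarith

/-! ### Paths generated by a signed measure -/

/-- The increments of the difference of the two Jordan distribution functions are dominated by those
of their sum, which is monotone and bounded. -/
theorem boundedVariationOn_signedMeasure_Iic (m : SignedMeasure ℝ) :
    BoundedVariationOn (fun t => m (Iic t)) univ := by
  set p := fun t => m.toJordanDecomposition.posPart.real (Iic t) with hp
  set q := fun t => m.toJordanDecomposition.negPart.real (Iic t) with hq
  have hpm : Monotone p := fun a b hab => measureReal_mono (Iic_subset_Iic.2 hab)
  have hqm : Monotone q := fun a b hab => measureReal_mono (Iic_subset_Iic.2 hab)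
  have hb : BoundedVariationOn (p + q) univ := by
    refine ((hpm.add hqm).monotoneOn univ).boundedVariationOn
      (C := m.toJordanDecomposition.posPart.real univ + m.toJordanDecomposition.negPart.real univ)
      fun x _ => ?_
    rw [Pi.add_apply, abs_of_nonneg (add_nonneg measureReal_nonneg measureReal_nonneg)]
    exact add_le_add (measureReal_mono (subset_univ _)) (measureReal_mono (subset_univ _))
  refine ne_top_of_le_ne_top hb (iSup_le fun r => ?_)
  refine le_trans ?_ (le_iSup _ r)
  refine Finset.sum_le_sum fun i _ => ?_
  rw [edist_dist, edist_dist, Real.dist_eq, Real.dist_eq]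
  refine ENNReal.ofReal_le_ofReal ?_
  have h1 := hpm (r.2.2.1 (Nat.le_succ i))
  have h2 := hqm (r.2.2.1 (Nat.le_succ i))
  simp only [signedMeasure_apply_eq m measurableSet_Iic, Pi.add_apply]
  rw [abs_of_nonneg (a := _ + _ - _) (by
    simp only [Nat.succ_eq_add_one] at h1 h2; linarith), abs_le]
  simp only [Nat.succ_eq_add_one, hp, hq] at h1 h2 ⊢
  constructor <;> linarith

theorem continuousWithinAt_signedMeasure_Iic (m : SignedMeasure ℝ) (x : ℝ) :
    ContinuousWithinAt (fun t => m (Iic t)) (Ici x) x := by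
  simp only [signedMeasure_apply_eq m measurableSet_Iic]
  exact (continuousWithinAt_measureReal_Iic _ x).sub (continuousWithinAt_measureReal_Iic _ x)

theorem vectorMeasure_signedMeasure_Iic (m : SignedMeasure ℝ) (h0 : ∀ t < 0, m (Iic t) = 0)
    (h : BoundedVariationOn (fun t => m (Iic t)) univ) : h.vectorMeasure = m := by
  have hbot : limUnder atBot (fun t => m (Iic t)) = 0 := by
    refine Tendsto.limUnder_eq (tendsto_const_nhds.congr' ?_)
    filter_upwards [eventually_lt_atBot (0 : ℝ)] with t ht using (h0 t ht).symm
  have htop : limUnder atTop (fun t => m (Iic t)) = m univ := by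
    refine Tendsto.limUnder_eq ?_
    simp only [signedMeasure_apply_eq m measurableSet_Iic, signedMeasure_apply_eq m .univ]
    have (μ : Measure ℝ) [IsFiniteMeasure μ] :
        Tendsto (fun t => μ.real (Iic t)) atTop (𝓝 (μ.real univ)) :=
      (ENNReal.tendsto_toReal (measure_ne_top _ _)).comp (tendsto_measure_Iic_atTop μ)
    exact (this _).sub (this _)
  refine VectorMeasure.ext_of_generateFrom (range Iic) ?_
    (by rw [← borel_eq_generateFrom_Iic ℝ]; exact BorelSpace.measurable_eq) isPiSystem_Iic ?_
  · rintro _ ⟨t, rfl⟩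
    rw [h.vectorMeasure_Iic, hbot, sub_zero]
    exact ContinuousWithinAt.rightLim_eq (f := fun t => m (Iic t))
      (continuousWithinAt_signedMeasure_Iic m t)
  · rw [h.vectorMeasure_univ, hbot, htop, sub_zero]

/-- Used to build paths from measures: `pathMeasure` returns the given measure, so its Lebesgue
decomposition is known in advance. A measure without mass outside `[0,1]` has a distribution
function that `extend` leaves unchanged. -/
theorem isPath_signedMeasure_Iic {m : SignedMeasure ℝ} (h0 : ∀ t < 0, m (Iic t) = 0)
    (h1 : ∀ t, 1 < t → m (Iic t) = m (Iic 1)) (hm : ∀ t ∈ Icc (0 : ℝ) 1, 0 ≤ m (Iic t)) :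
    IsPath (fun t => m (Iic t)) ∧ pathMeasure (fun t => m (Iic t)) = m := by
  have hb := boundedVariationOn_signedMeasure_Iic m
  refine ⟨⟨hm, fun t _ => continuousWithinAt_signedMeasure_Iic m t, fun t _ => ?_,
    hb.mono (subset_univ _)⟩, ?_⟩
  · exact ⟨_, hb.tendsto_leftLim t⟩
  · have he : extend (fun t => m (Iic t)) = fun t => m (Iic t) := by
      funext t
      rcases lt_or_ge t 0 with ht | ht
      · simp [extend, ht, h0 t ht]
      · rcases le_or_gt t 1 with ht1 | ht1
        · simp [extend, not_lt.2 ht, ht1]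
        · simp [extend, not_lt.2 ht, ht1.le, h1 t ht1]
    have hb' : BoundedVariationOn (extend fun t => m (Iic t)) univ := by rwa [he]
    rw [pathMeasure, dif_pos hb']
    have : hb'.vectorMeasure = hb.vectorMeasure := by congr
    rw [this, vectorMeasure_signedMeasure_Iic m h0]

/-- The signed measure with an atom of mass `a` at `T` and density `f`. -/
noncomputable def atomDensity (T a : ℝ) (f : ℝ → ℝ) : SignedMeasure ℝ :=
  (a.toNNReal • Measure.dirac T).toSignedMeasure + volume.withDensityᵥ f

theorem atomDensity_Iic {T a : ℝ} (ha : 0 ≤ a) {f : ℝ → ℝ} (hf : Integrable f) (t : ℝ) :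
    atomDensity T a f (Iic t) = (if T ≤ t then a else 0) + ∫ s in Iic t, f s := by
  rw [atomDensity, _root_.add_apply, withDensityᵥ_apply hf measurableSet_Iic,
    Measure.toSignedMeasure_apply_measurable measurableSet_Iic]
  congr 1
  rw [measureReal_def, Measure.smul_apply, Measure.dirac_apply' _ measurableSet_Iic,
    ENNReal.smul_def, smul_eq_mul, ENNReal.toReal_mul]
  by_cases h : T ≤ t <;> simp [h, ha]

theorem toJordanDecomposition_toSignedMeasure (μ : Measure ℝ) [IsFiniteMeasure μ] :
    μ.toSignedMeasure.toJordanDecomposition =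
      @JordanDecomposition.mk _ _ μ 0 _ _ Measure.MutuallySingular.zero_right := by
  refine SignedMeasure.toJordanDecomposition_eq ?_
  simp [JordanDecomposition.toSignedMeasure]

theorem atomDensity_mutuallySingular (T a : ℝ) :
    (a.toNNReal • Measure.dirac T).toSignedMeasure ⟂ᵥ
      (volume : Measure ℝ).toENNRealVectorMeasure := by
  rw [SignedMeasure.mutuallySingular_ennreal_iff, SignedMeasure.totalVariation,
    toJordanDecomposition_toSignedMeasure,
    VectorMeasure.ennrealToMeasure_toENNRealVectorMeasure]
  simp only [add_zero]
  exact (mutuallySingular_dirac T volume).smul _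

/-- The splitting into atom and density already is the Lebesgue decomposition. An inequality is
enough, since time spent at zero is free: `inf_{y ≤ 0} I y = I (-δ) = 0`. -/
theorem J_atomDensity_le {I : ℝ → ℝ≥0∞} {δ : ℝ} (hδ : 0 < δ) (hIδ : I (-δ) = 0)
    {T a : ℝ} (hT : T ∈ Ico (0 : ℝ) 1) (ha : 0 ≤ a) {f : ℝ → ℝ} (hf : Integrable f)
    (hsupp : ∀ t ∉ Ioc T 1, f t = 0) (hpos : ∀ t ∈ Icc T 1, 0 ≤ a + ∫ s in Ioc T t, f s) :
    ∃ ψ : ℝ → ℝ, IsPath ψ ∧ (∀ t < T, ψ t = 0) ∧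
      (∀ t ∈ Icc T 1, ψ t = a + ∫ s in Ioc T t, f s) ∧
      J I ψ ≤ thetaUp I * ENNReal.ofReal a + ∫⁻ s in Ioc T 1, I (f s) := by
  have hlt : ∀ t < T, atomDensity T a f (Iic t) = 0 := by
    intro t ht
    rw [atomDensity_Iic ha hf, if_neg (not_le.2 ht), zero_add]
    refine setIntegral_eq_zero_of_forall_eq_zero fun s hs => hsupp s fun h => ?_
    exact absurd (h.1.trans_le hs) (not_lt.2 ht.le)
  have hint : ∀ t, T ≤ t → ∫ s in Iic t, f s = ∫ s in Ioc T t, f s := by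
    intro t ht
    exact setIntegral_eq_of_subset_of_forall_sdiff_eq_zero measurableSet_Iic
      Ioc_subset_Iic_self fun s hs => hsupp s fun h => hs.2 ⟨h.1, hs.1⟩
  have heq : ∀ t, T ≤ t → atomDensity T a f (Iic t) = a + ∫ s in Ioc T t, f s := by
    intro t ht
    rw [atomDensity_Iic ha hf, if_pos ht, hint t ht]
  obtain ⟨hpath, hmeas⟩ := isPath_signedMeasure_Iic (m := atomDensity T a f)
    (fun t ht => hlt t (ht.trans_le hT.1))
    (fun t ht => by
      rw [heq t (hT.2.le.trans ht.le), heq 1 hT.2.le]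
      congr 1
      refine (setIntegral_eq_of_subset_of_forall_sdiff_eq_zero measurableSet_Ioc
        (Ioc_subset_Ioc_right ht.le) fun s hs => hsupp s hs.2))
    (fun t ht => by
      rcases lt_or_ge t T with h | h
      · rw [hlt t h]
      · rw [heq t h]; exact hpos t ⟨h, ht.2⟩)
  refine ⟨_, hpath, hlt, fun t ht => heq t ht.1, ?_⟩
  have hs : (pathMeasure fun t => atomDensity T a f (Iic t)).singularPart volume
      = (a.toNNReal • Measure.dirac T).toSignedMeasure := by
    rw [hmeas]
    exact (SignedMeasure.eq_singularPart _ f (atomDensity_mutuallySingular T a) rfl).symm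
  have hd : f =ᵐ[volume] acDeriv fun t => atomDensity T a f (Iic t) := by
    rw [acDeriv, hmeas]
    exact SignedMeasure.eq_rnDeriv _ f hf (atomDensity_mutuallySingular T a) rfl
  have hup : singUp (fun t => atomDensity T a f (Iic t)) = ENNReal.ofReal a := by
    rw [singUp, hs, toJordanDecomposition_toSignedMeasure]
    rw [Measure.smul_apply, measure_univ, ENNReal.smul_def, smul_eq_mul, mul_one]
    rfl
  have hdown : singDown (fun t => atomDensity T a f (Iic t)) = 0 := by
    rw [singDown, hs, toJordanDecomposition_toSignedMeasure]
    simp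
  rw [J, hup, hdown, mul_zero, add_zero, add_comm, iInf_nonpos_eq_zero hδ hIδ]
  gcongr 1
  rw [← lintegral_indicator measurableSet_Icc, ← lintegral_indicator measurableSet_Ioc]
  have hne : ∀ᵐ s : ℝ, s ≠ T := by simp [ae_iff]
  refine lintegral_mono_ae ?_
  filter_upwards [hd, hne] with s hs hsT
  by_cases h : s ∈ Icc (0 : ℝ) 1
  · rw [indicator_of_mem h]
    split_ifs with hψ
    · have : s ∈ Ioc T 1 := by
        refine ⟨?_, h.2⟩
        by_contra! hle
        rw [hlt s (lt_of_le_of_ne hle hsT)] at hψ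
        exact lt_irrefl _ hψ
      rw [indicator_of_mem this, ← hs]
    · exact zero_le
  · rw [indicator_of_notMem h]
    exact zero_le

/-! ### Concave profiles -/

/-- The concave profile with initial value `a` and slope `y`. -/
noncomputable def profile (a : ℝ) (y : ℝ → ℝ) (t : ℝ) : ℝ := a + ∫ u in (0 : ℝ)..t, y u

/-- The data of a concave excursion of length `ℓ`: initial value `a` and antitone slope `y ≥ -δ`,
continued by `-δ` after time `ℓ`. -/
structure IsProfile (δ ℓ a : ℝ) (y : ℝ → ℝ) : Prop where
  length_pos : 0 < ℓ
  length_le : ℓ ≤ 1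
  start_nonneg : 0 ≤ a
  -- The slope may blow up at `0`, so nothing is asked there.
  antitoneOn : AntitoneOn y (Ioi 0)
  le_slope : ∀ u, 0 < u → -δ ≤ y u
  -- The tail is free because `I (-δ) = 0`, so costs can be integrated over `(0,1]` whatever `ℓ` is.
  slope_tail : ∀ u, ℓ < u → y u = -δ
  integrable : ∀ R, 0 ≤ R → IntervalIntegrable y volume 0 R
  end_nonneg : 0 ≤ profile a y ℓ

/-- The cost of a profile. -/
noncomputable def profileCost (I : ℝ → ℝ≥0∞) (a : ℝ) (y : ℝ → ℝ) : ℝ≥0∞ :=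
  thetaUp I * ENNReal.ofReal a + ∫⁻ u in Ioc (0 : ℝ) 1, I (y u)

/-- The area under a profile of length `ℓ`. -/
noncomputable def profileArea (ℓ a : ℝ) (y : ℝ → ℝ) : ℝ := ∫ t in (0 : ℝ)..ℓ, profile a y t

variable {δ ℓ a : ℝ} {y : ℝ → ℝ}

/-- The value `y q` separates the slopes of the chords over `[p,q]` and `[q,r]`. -/
theorem concaveOn_profile (hy : AntitoneOn y (Ioi 0))
    (hint : ∀ R, 0 ≤ R → IntervalIntegrable y volume 0 R) :
    ConcaveOn ℝ (Ici 0) (profile a y) := by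
  have hii : ∀ p q, 0 ≤ p → 0 ≤ q → IntervalIntegrable y volume p q := fun p q hp hq =>
    (hint p hp).symm.trans (hint q hq)
  have hdiff : ∀ p q, 0 ≤ p → 0 ≤ q → profile a y q - profile a y p = ∫ u in p..q, y u := by
    intro p q hp hq
    rw [profile, profile, add_sub_add_left_eq_sub,
      intervalIntegral.integral_interval_sub_left (hint q hq) (hint p hp)]
  refine concaveOn_of_slope_anti_adjacent (convex_Ici 0) ?_
  intro p q r hp hr hpq hqr
  have hp0 : 0 ≤ p := hp
  have hq0 : 0 < q := hp0.trans_lt hpq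
  rw [hdiff q r hq0.le hr, hdiff p q hp0 hq0.le]
  have h1 : ∫ u in q..r, y u ≤ (r - q) * y q := by
    have := intervalIntegral.integral_mono_on hqr.le (hii q r hq0.le hr)
      (intervalIntegrable_const (c := y q))
      (fun u hu => hy hq0 (hq0.trans_le hu.1) hu.1)
    simpa using this
  have h2 : (q - p) * y q ≤ ∫ u in p..q, y u := by
    have := intervalIntegral.integral_mono_on_of_le_Ioo hpq.le
      (intervalIntegrable_const (c := y q)) (hii p q hp0 hq0.le)
      (fun u hu => hy (hp0.trans_lt hu.1) hq0 hu.2.le)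
    simpa using this
  calc (∫ u in q..r, y u) / (r - q) ≤ y q := by
        rw [div_le_iff₀ (by linarith), mul_comm]; exact h1
    _ ≤ (∫ u in p..q, y u) / (q - p) := by
        rw [le_div_iff₀ (by linarith), mul_comm]; exact h2

theorem continuousOn_profile (h : IntervalIntegrable y volume 0 1) :
    ContinuousOn (profile a y) (Icc 0 1) :=
  continuousOn_const.add (by
    have := intervalIntegral.continuousOn_primitive_interval' h left_mem_uIcc
    rwa [uIcc_of_le zero_le_one] at this)

namespace IsProfile

theorem concaveOn (h : IsProfile δ ℓ a y) : ConcaveOn ℝ (Ici 0) (profile a y) :=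
  concaveOn_profile h.antitoneOn h.integrable

theorem nonneg (h : IsProfile δ ℓ a y) {t : ℝ} (ht : t ∈ Icc 0 ℓ) : 0 ≤ profile a y t := by
  have := h.concaveOn.min_le_of_mem_Icc (x := 0) (y := ℓ) (z := t) self_mem_Ici
    h.length_pos.le ht
  refine le_trans (le_min ?_ h.end_nonneg) this
  simpa [profile] using h.start_nonneg

theorem continuousOn (h : IsProfile δ ℓ a y) : ContinuousOn (profile a y) (Icc 0 1) :=
  continuousOn_profile (h.integrable 1 zero_le_one)

/-- The path waits at zero until `1 - ℓ` and ends with the profile at time `1`, so a positive final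
value needs no downward jump. -/
theorem exists_path (h : IsProfile δ ℓ a y) (hδ : 0 < δ) {I : ℝ → ℝ≥0∞}
    (hIδ : I (-δ) = 0) :
    ∃ ψ, Feasible (profileArea ℓ a y) ψ ∧ J I ψ ≤ profileCost I a y := by
  have hl := h.length_pos
  have hl1 := h.length_le
  have hT : 1 - ℓ ∈ Ico (0 : ℝ) 1 := ⟨by linarith, by linarith⟩
  set T := 1 - ℓ with hTdef
  set f : ℝ → ℝ := (Ioc T 1).indicator fun t => y (t - T) with hf
  have hyi : IntervalIntegrable (fun t => y (t - T)) volume T 1 := by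
    have := (h.integrable ℓ hl.le).comp_sub_right T
    simpa [hTdef] using this
  have hfi : Integrable f :=
    (((intervalIntegrable_iff_integrableOn_Ioc_of_le hT.2.le).1 hyi)).integrable_indicator
      measurableSet_Ioc
  have hfint : ∀ t ∈ Icc T 1, a + ∫ s in Ioc T t, f s = profile a y (t - T) := by
    intro t ht
    rw [profile, hf]
    congr 1
    rw [setIntegral_congr_fun (g := fun t => y (t - T)) measurableSet_Ioc
      (fun s hs => indicator_of_mem (show s ∈ Ioc T 1 from ⟨hs.1, hs.2.trans ht.2⟩) _),
      ← intervalIntegral.integral_of_le ht.1]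
    simp
  obtain ⟨ψ, hψ, hlt, hge, hJ⟩ := J_atomDensity_le (I := I) hδ hIδ hT h.start_nonneg hfi
    (fun t ht => indicator_of_notMem ht _) (fun t ht => by
      rw [hfint t ht]
      exact h.nonneg ⟨by linarith [ht.1], by linarith [ht.2]⟩)
  refine ⟨ψ, ⟨hψ, ?_⟩, hJ.trans ?_⟩
  · have e1 : ∀ᵐ s : ℝ, s ∈ uIoc 0 T → ψ s = 0 := by
      have hne : ∀ᵐ s : ℝ, s ≠ T := by simp [ae_iff]
      filter_upwards [hne] with s hs hs'
      rw [uIoc_of_le hT.1] at hs'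
      exact hlt s (lt_of_le_of_ne hs'.2 hs)
    have e2 : EqOn (fun s => profile a y (s - T)) ψ (uIcc T 1) := by
      intro s hs
      rw [uIcc_of_le hT.2.le] at hs
      simp only
      rw [hge s hs, hfint s hs]
    have hc : ContinuousOn (fun s => profile a y (s - T)) (uIcc T 1) := by
      rw [uIcc_of_le hT.2.le]
      exact h.continuousOn.comp (by fun_prop) fun s hs =>
        ⟨by linarith [hs.1], by linarith [hs.2, hT.1]⟩
    have i2 : IntervalIntegrable ψ volume T 1 :=
      hc.intervalIntegrable.congr (fun s hs => e2 (uIoc_subset_uIcc hs))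
    have i1 : IntervalIntegrable ψ volume 0 T := by
      refine (intervalIntegrable_const (c := (0 : ℝ))).congr_ae ?_
      rw [Filter.EventuallyEq, ae_restrict_iff' measurableSet_uIoc]
      filter_upwards [e1] with s hs hs' using (hs hs').symm
    rw [← intervalIntegral.integral_add_adjacent_intervals i1 i2,
      intervalIntegral.integral_congr_ae (g := fun _ => 0) e1,
      ← intervalIntegral.integral_congr e2, profileArea]
    simp [hTdef]
  · rw [profileCost]
    gcongr 1
    have e3 : ∫⁻ s in Ioc T 1, I (f s) = ∫⁻ s in Ioc T 1, I (y (s - T)) :=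
      setLIntegral_congr_fun measurableSet_Ioc fun s hs => by simp only [hf, indicator_of_mem hs]
    rw [e3, ← lintegral_indicator measurableSet_Ioc, ← lintegral_indicator measurableSet_Ioc,
      ← lintegral_sub_right_eq_self (fun s => (Ioc (0 : ℝ) 1).indicator (fun u => I (y u)) s) T]
    refine lintegral_mono fun s => ?_
    by_cases hs : s ∈ Ioc T 1
    · rw [indicator_of_mem hs, indicator_of_mem
        (show s - T ∈ Ioc (0 : ℝ) 1 from ⟨by linarith [hs.1], by linarith [hs.2, hT.1]⟩)]
    · rw [indicator_of_notMem hs]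
      exact zero_le

/-- Time and space shrink by the same factor, so the slopes keep their values: area scales like `c²`
and cost like `c`. -/
theorem profile_scale {c : ℝ} (hc : c ≠ 0) (t : ℝ) :
    profile (c * a) (fun u => y (u / c)) t = c * profile a y (t / c) := by
  rw [profile, profile, intervalIntegral.integral_comp_div (fun u => y u) hc, mul_add]
  simp

theorem scale (h : IsProfile δ ℓ a y) {c : ℝ} (hc : 0 < c) (hc1 : c ≤ 1) :
    IsProfile δ (c * ℓ) (c * a) (fun u => y (u / c)) where
  length_pos := mul_pos hc h.length_pos
  length_le := mul_le_one₀ hc1 h.length_pos.le h.length_le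
  start_nonneg := mul_nonneg hc.le h.start_nonneg
  antitoneOn := fun u hu v hv huv => h.antitoneOn (div_pos hu hc) (div_pos hv hc)
    (div_le_div_of_nonneg_right huv hc.le)
  le_slope := fun u hu => h.le_slope _ (div_pos hu hc)
  slope_tail := fun u hu => h.slope_tail _ (by rwa [lt_div_iff₀ hc, mul_comm])
  integrable := fun R hR => by
    have := (h.integrable (R / c) (div_nonneg hR hc.le)).comp_mul_right (c := c⁻¹)
    simpa [div_eq_mul_inv, hc.ne'] using this
  end_nonneg := by
    rw [profile_scale hc.ne', mul_div_cancel_left₀ _ hc.ne']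
    exact mul_nonneg hc.le h.end_nonneg

theorem profileArea_scale {c : ℝ} (hc : c ≠ 0) :
    profileArea (c * ℓ) (c * a) (fun u => y (u / c)) = c ^ 2 * profileArea ℓ a y := by
  rw [profileArea, profileArea]
  simp_rw [profile_scale hc]
  rw [intervalIntegral.integral_const_mul,
    intervalIntegral.integral_comp_div (fun u => profile a y u) hc]
  simp only [zero_div, smul_eq_mul]
  rw [mul_div_cancel_left₀ _ hc]
  ring

theorem profileCost_scale (h : IsProfile δ ℓ a y) {I : ℝ → ℝ≥0∞} (hIδ : I (-δ) = 0)
    {c : ℝ} (hc : 0 < c) (hc1 : c ≤ 1) :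
    profileCost I (c * a) (fun u => y (u / c)) = ENNReal.ofReal c * profileCost I a y := by
  rw [profileCost, profileCost, mul_add, ENNReal.ofReal_mul hc.le]
  congr 1
  · ring
  -- Slopes after time `1` are `-δ` and cost nothing, so both integrals extend to `(0,∞)`, where the
  -- change of variables has no boundary.
  · set g : ℝ → ℝ≥0∞ := (Ioi (0 : ℝ)).indicator fun u => I (y u) with hg
    have key : ∀ u, 1 < u → g u = 0 := fun u hu => by
      rw [hg, indicator_of_mem (show u ∈ Ioi (0 : ℝ) from zero_lt_one.trans hu), h.slope_tail u (h.length_le.trans_lt hu),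
        hIδ]
    have e1 : ∫⁻ u in Ioc (0 : ℝ) 1, I (y u) = ∫⁻ u, g u := by
      rw [← lintegral_indicator measurableSet_Ioc]
      refine lintegral_congr fun u => ?_
      rcases le_or_gt u 0 with h0 | h0
      · simp [hg, h0.not_gt]
      · rcases le_or_gt u 1 with h1 | h1
        · simp [hg, h0, h1]
        · rw [key u h1, indicator_of_notMem fun hu => absurd hu.2 (not_le.2 h1)]
    have e2 : ∫⁻ u in Ioc (0 : ℝ) 1, I (y (u / c)) = ∫⁻ u, g (c⁻¹ * u) := by
      rw [← lintegral_indicator measurableSet_Ioc]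
      refine lintegral_congr fun u => ?_
      have hd : u / c = c⁻¹ * u := by rw [div_eq_mul_inv, mul_comm]
      rcases le_or_gt u 0 with h0 | h0
      · have : c⁻¹ * u ≤ 0 := mul_nonpos_of_nonneg_of_nonpos (inv_nonneg.2 hc.le) h0
        simp [hg, h0.not_gt, this.not_gt]
      · have h0' : 0 < c⁻¹ * u := mul_pos (inv_pos.2 hc) h0
        rcases le_or_gt u 1 with h1 | h1
        · rw [indicator_of_mem (show u ∈ Ioc (0 : ℝ) 1 from ⟨h0, h1⟩), hg,
            indicator_of_mem (show c⁻¹ * u ∈ Ioi (0 : ℝ) from h0'), hd]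
        · rw [key (c⁻¹ * u) (h1.trans_le (by
              have := (one_le_inv₀ hc).2 hc1
              nlinarith)),
            indicator_of_notMem fun hu => absurd hu.2 (not_le.2 h1)]
    rw [e1, e2]
    have hm := lintegral_map_equiv (μ := volume) g (Homeomorph.mulLeft₀ c⁻¹
      (inv_ne_zero hc.ne')).toMeasurableEquiv
    have hv : Measure.map (Homeomorph.mulLeft₀ c⁻¹ (inv_ne_zero hc.ne')).toMeasurableEquiv
        (volume : Measure ℝ) = ENNReal.ofReal c • volume := by
      have := Real.map_volume_mul_left (inv_ne_zero hc.ne')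
      rw [inv_inv, abs_of_pos hc] at this
      exact this
    rw [hv, lintegral_smul_measure] at hm
    exact hm.symm

/-- Zero cost forces `a = 0` and nonpositive slopes, hence no area. Positivity makes scaling down
strictly profitable. -/
theorem profileCost_pos (h : IsProfile δ ℓ a y) {I : ℝ → ℝ≥0∞} (hI : Measurable I)
    (hpos : ∀ y, 0 < y → 0 < I y) (hθ : 0 < thetaUp I) (harea : 0 < profileArea ℓ a y) :
    0 < profileCost I a y := by
  by_contra! h0
  rw [nonpos_iff_eq_zero, profileCost, add_eq_zero, mul_eq_zero, ENNReal.ofReal_eq_zero] at h0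
  have ha : a = 0 := le_antisymm (h0.1.resolve_left hθ.ne') h.start_nonneg
  have hym : AEMeasurable y (volume.restrict (Ioc 0 1)) :=
    ((intervalIntegrable_iff_integrableOn_Ioc_of_le zero_le_one).1
      (h.integrable 1 zero_le_one)).aemeasurable
  have hy := (lintegral_eq_zero_iff' (hI.comp_aemeasurable hym)).1 h0.2
  have hy0 : ∀ᵐ u ∂(volume.restrict (Ioc (0 : ℝ) 1)), y u ≤ 0 := by
    filter_upwards [hy] with u hu
    by_contra! hlt
    exact (hpos _ hlt).ne' hu
  have hneg : ∀ t ∈ Icc 0 ℓ, profile a y t ≤ 0 := by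
    intro t ht
    rw [profile, ha, zero_add, intervalIntegral.integral_of_le ht.1]
    refine integral_nonpos_of_ae (ae_mono (Measure.restrict_mono_set _ ?_) hy0)
    exact Ioc_subset_Ioc_right (ht.2.trans h.length_le)
  refine absurd harea (not_lt.2 ?_)
  rw [profileArea]
  have := intervalIntegral.integral_mono_on h.length_pos.le (μ := volume) (f := profile a y)
    (g := fun _ => 0) ?_ intervalIntegrable_const hneg
  · simpa using this
  · refine (h.continuousOn.mono ?_).intervalIntegrable
    rw [uIcc_of_le h.length_pos.le]
    exact Icc_subset_Icc_right h.length_le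

end IsProfile

/-! ### Decreasing rearrangement -/

/-- The quantile function of the upper tails of a measure. -/
noncomputable def upperQuantile (ν : Measure ℝ) (u : ℝ) : ℝ := sInf {s | ν.real (Ioi s) ≤ u}

/-- The upper tail is right continuous, so the infimum is attained; for `u` strictly between `0` and
the total mass the set is nonempty and bounded below. -/
theorem upperQuantile_le_iff (ν : Measure ℝ) [IsFiniteMeasure ν] {u s : ℝ}
    (hu : u ∈ Ioo 0 (ν.real univ)) : upperQuantile ν u ≤ s ↔ ν.real (Ioi s) ≤ u := by
  have hanti : Antitone fun s => ν.real (Ioi s) := fun p q hpq =>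
    measureReal_mono (Ioi_subset_Ioi hpq)
  have hcompl : ∀ s, ν.real (Ioi s) = ν.real univ - ν.real (Iic s) := fun s => by
    rw [← compl_Iic, measureReal_compl measurableSet_Iic]
  have htop : Tendsto (fun s => ν.real (Ioi s)) atTop (𝓝 0) := by
    have := (ENNReal.tendsto_toReal (measure_ne_top ν univ)).comp (tendsto_measure_Iic_atTop ν)
    simp_rw [hcompl]
    have h2 := this.const_sub (ν.real univ)
    rwa [← measureReal_def, sub_self] at h2
  have hbot : Tendsto (fun s => ν.real (Ioi s)) atBot (𝓝 (ν.real univ)) := by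
    have := (ENNReal.tendsto_toReal (measure_ne_top ν univ)).comp (tendsto_measure_Ici_atBot ν)
    refine tendsto_of_tendsto_of_tendsto_of_le_of_le (this.comp (tendsto_atBot_add_const_right
      atBot (1 : ℝ) tendsto_id)) tendsto_const_nhds (fun s => ?_) fun s =>
        measureReal_mono (subset_univ _)
    refine measureReal_mono (μ := ν) fun x hx => ?_
    simp only [id, mem_Ici, mem_Ioi] at hx ⊢
    linarith
  have hne : {s | ν.real (Ioi s) ≤ u}.Nonempty :=
    ((htop.eventually_lt_const hu.1).mono fun s hs => hs.le).exists
  have hbdd : BddBelow {s | ν.real (Ioi s) ≤ u} := by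
    obtain ⟨b, hb⟩ := (hbot.eventually_const_lt hu.2).exists
    exact ⟨b, fun s hs => by
      by_contra! hlt
      exact absurd (hb.trans_le (hanti hlt.le)) (not_lt.2 hs)⟩
  refine ⟨fun h => ?_, fun h => csInf_le hbdd h⟩
  have hcont : ContinuousWithinAt (fun s => ν.real (Ioi s)) (Ici s) s := by
    simp_rw [hcompl]
    exact continuousWithinAt_const.sub (continuousWithinAt_measureReal_Iic ν s)
  refine le_of_tendsto (hcont.mono Ioi_subset_Ici_self) ?_
  filter_upwards [self_mem_nhdsWithin] with r hr
  obtain ⟨q, hq, hqr⟩ := exists_lt_of_csInf_lt hne (h.trans_lt hr)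
  exact (hanti hqr.le).trans hq

theorem antitoneOn_upperQuantile (ν : Measure ℝ) [IsFiniteMeasure ν] :
    AntitoneOn (upperQuantile ν) (Ioo 0 (ν.real univ)) := by
  intro u hu v hv huv
  rw [upperQuantile_le_iff ν hv]
  exact ((upperQuantile_le_iff ν hu).1 le_rfl).trans huv

theorem aemeasurable_upperQuantile (ν : Measure ℝ) [IsFiniteMeasure ν] :
    AEMeasurable (upperQuantile ν) (volume.restrict (Ioo 0 (ν.real univ))) :=
  aemeasurable_restrict_of_antitoneOn measurableSet_Ioo (antitoneOn_upperQuantile ν)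

theorem map_upperQuantile (ν : Measure ℝ) [IsFiniteMeasure ν] :
    (volume.restrict (Ioo 0 (ν.real univ))).map (upperQuantile ν) = ν := by
  refine Measure.ext_of_Iic _ _ fun s => ?_
  rw [Measure.map_apply_of_aemeasurable (aemeasurable_upperQuantile ν) measurableSet_Iic,
    Measure.restrict_apply' measurableSet_Ioo]
  have e : ν (Iic s) = ENNReal.ofReal (ν.real univ - ν.real (Ioi s)) := by
    rw [← compl_Iic, measureReal_compl measurableSet_Iic, sub_sub_cancel, ofReal_measureReal]
  rw [e]
  have hle : ν.real (Ioi s) ≤ ν.real univ := measureReal_mono (subset_univ _)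
  -- The preimage of `Iic s` lies between the intervals `Ioo` and `Ico` from `ν.real (Ioi s)` to the
  -- total mass.
  refine le_antisymm ?_ ?_
  · rw [← Real.volume_Ico]
    refine measure_mono fun u hu => ⟨(upperQuantile_le_iff ν hu.2).1 hu.1, hu.2.2⟩
  · rw [← Real.volume_Ioo]
    refine measure_mono fun u hu => ?_
    have hu' : u ∈ Ioo 0 (ν.real univ) := ⟨measureReal_nonneg.trans_lt hu.1, hu.2⟩
    exact ⟨(upperQuantile_le_iff ν hu').2 hu.1.le, hu'⟩

/-- `w` is the upper quantile function of the law of `g` on `P`, hence equimeasurable with `g`. The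
last clause is of Hardy–Littlewood type: with `v = |E|` and `s = w v`, `∫_E (g - s) ≤ ∫_P (g - s)⁺ =
∫ (w - s)⁺ = ∫_0^v (w - s)`. -/
theorem exists_antitone_rearrangement {P : Set ℝ} (hP : volume P ≠ ⊤)
    {g : ℝ → ℝ} (hgm : Measurable g) (hg : IntegrableOn g P) :
    ∃ w : ℝ → ℝ, AntitoneOn w (Ioo 0 (volume.real P)) ∧
      IntegrableOn w (Ioo 0 (volume.real P)) ∧
      (∀ F : ℝ → ℝ≥0∞, Measurable F →
        ∫⁻ u in Ioo 0 (volume.real P), F (w u) = ∫⁻ t in P, F (g t)) ∧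
      ∀ E ⊆ P, MeasurableSet E →
        ∫ t in E, g t ≤ ∫ u in Ioo 0 (volume.real E), w u := by
  have : IsFiniteMeasure (volume.restrict P) := ⟨by simpa using hP.lt_top⟩
  set ν := (volume.restrict P).map g with hν
  have hl : ν.real univ = volume.real P := by
    rw [measureReal_def, hν, Measure.map_apply hgm .univ]
    simp [measureReal_def]
  have hmap := map_upperQuantile ν
  have hanti := antitoneOn_upperQuantile ν
  have hwm := aemeasurable_upperQuantile ν
  rw [hl] at hmap hanti hwm
  set w := upperQuantile ν
  set ℓ := volume.real P with hℓ
  have hF : ∀ F : ℝ → ℝ, Measurable F → ∫ u in Ioo 0 ℓ, F (w u) = ∫ t in P, F (g t) := by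
    intro F hF
    rw [← integral_map hwm hF.aestronglyMeasurable, hmap, hν,
      integral_map hgm.aemeasurable hF.aestronglyMeasurable]
  have hwi : IntegrableOn w (Ioo 0 ℓ) := by
    have h1 : Integrable (fun x => x) ν := by
      rw [hν]
      exact (integrable_map_measure aestronglyMeasurable_id hgm.aemeasurable).2 hg
    rw [← hmap] at h1
    exact (integrable_map_measure aestronglyMeasurable_id hwm).1 h1
  refine ⟨w, hanti, hwi, fun F hFm => ?_, fun E hEP hEm => ?_⟩
  · rw [← lintegral_map' hFm.aemeasurable hwm, hmap, hν, lintegral_map hFm hgm]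
  · set v := volume.real E with hv
    have hE : volume E ≠ ⊤ := ne_top_of_le_ne_top hP (measure_mono hEP)
    have hvl : v ≤ ℓ := measureReal_mono hEP hP
    -- The threshold `w v` is meaningful only for `v` strictly inside `(0,ℓ)`, so the two extreme
    -- cases are treated apart.
    rcases hvl.eq_or_lt with hvl | hvl
    · have hae : E =ᵐ[volume] P := ae_eq_of_subset_of_measure_ge hEP (by
        rw [← ofReal_measureReal hP, ← ofReal_measureReal hE]
        exact ENNReal.ofReal_le_ofReal hvl.ge) hEm.nullMeasurableSet hP
      rw [setIntegral_congr_set hae, hvl]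
      exact (hF _ measurable_id).ge
    rcases (measureReal_nonneg (μ := volume) (s := E)).eq_or_lt with h0 | h0
    · have : volume E = 0 := by
        rw [← ofReal_measureReal hE, ← h0, ENNReal.ofReal_zero]
      rw [Measure.restrict_eq_zero.2 this, hv, ← h0]
      simp
    rw [← hv] at h0
    set s := w v with hs
    have hgE : IntegrableOn g E := hg.mono_set hEP
    have hcE : IntegrableOn (fun _ => s) E := integrableOn_const hE
    have hposP : IntegrableOn (fun t => max (g t - s) 0) P :=
      (hg.sub (integrableOn_const hP)).pos_part
    have hsub : Ioo 0 v ⊆ Ioo 0 ℓ := Ioo_subset_Ioo_right hvl.le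
    have hvm : v ∈ Ioo 0 ℓ := ⟨h0, hvl⟩
    have e1 : ∫ t in E, g t = s * v + ∫ t in E, (g t - s) := by
      rw [integral_sub hgE hcE, setIntegral_const, smul_eq_mul, ← hv]
      ring
    have e2 : ∫ t in E, (g t - s) ≤ ∫ t in P, max (g t - s) 0 := by
      refine (setIntegral_mono (hgE.sub hcE) (hposP.mono_set hEP) fun t => le_max_left _ _).trans ?_
      exact setIntegral_mono_set hposP (Eventually.of_forall fun t => le_max_right _ _)
        hEP.eventuallyLE
    have e3 : ∫ t in P, max (g t - s) 0 = ∫ u in Ioo 0 ℓ, max (w u - s) 0 :=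
      (hF (fun x => max (x - s) 0) (by fun_prop)).symm
    have hne : ∀ᵐ u : ℝ, u ≠ v := by simp [ae_iff]
    have e4 : ∫ u in Ioo 0 ℓ, max (w u - s) 0 = ∫ u in Ioo 0 v, (w u - s) := by
      rw [← integral_indicator measurableSet_Ioo, ← integral_indicator measurableSet_Ioo]
      refine integral_congr_ae ?_
      filter_upwards [hne] with u huv
      by_cases hu : u ∈ Ioo 0 ℓ
      · rw [indicator_of_mem hu]
        rcases lt_or_gt_of_ne huv with h | h
        · rw [indicator_of_mem (show u ∈ Ioo 0 v from ⟨hu.1, h⟩)]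
          exact max_eq_left (sub_nonneg.2 (hanti hu hvm h.le))
        · rw [indicator_of_notMem fun hu' => absurd hu'.2 h.not_gt]
          exact max_eq_right (sub_nonpos.2 (hanti hvm hu h.le))
      · rw [indicator_of_notMem hu, indicator_of_notMem fun hu' => hu (hsub hu')]
    have e5 : ∫ u in Ioo 0 v, (w u - s) = (∫ u in Ioo 0 v, w u) - s * v := by
      rw [integral_sub (hwi.mono_set hsub) (integrableOn_const (by simp)), setIntegral_const]
      simp [h0.le, mul_comm]
    linarith

/-! ### The clock of a set -/

/-- The amount of time spent in `P` up to time `t`. -/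
noncomputable def clock (P : Set ℝ) (t : ℝ) : ℝ := volume.real (P ∩ Icc 0 t)

theorem clock_mono {P : Set ℝ} : Monotone (clock P) := fun s t hst =>
  measureReal_mono (inter_subset_inter_right _ (Icc_subset_Icc_right hst))
    (measure_inter_ne_top_of_right_ne_top (by simp))

theorem clock_le_add {P : Set ℝ} {s t : ℝ} (hst : s ≤ t) : clock P t ≤ clock P s + (t - s) := by
  have hsub : P ∩ Icc 0 t ⊆ (P ∩ Icc 0 s) ∪ Ioc s t := by
    rintro u ⟨hu, hu0, hut⟩
    rcases le_or_gt u s with h | h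
    · exact Or.inl ⟨hu, hu0, h⟩
    · exact Or.inr ⟨h, hut⟩
  refine (measureReal_mono hsub ?_).trans ((measureReal_union_le _ _).trans ?_)
  · exact measure_union_ne_top (measure_inter_ne_top_of_right_ne_top (by simp)) (by simp)
  · simp [clock, hst]

theorem continuous_clock {P : Set ℝ} : Continuous (clock P) := by
  refine (LipschitzWith.of_dist_le_mul (K := 1) fun s t => ?_).continuous
  rw [NNReal.coe_one, one_mul, Real.dist_eq, Real.dist_eq]
  wlog h : s ≤ t generalizing s t
  · rw [abs_sub_comm, abs_sub_comm s]
    exact this t s (le_of_not_ge h)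
  rw [abs_sub_comm, abs_sub_comm s, abs_of_nonneg (sub_nonneg.2 (clock_mono h)),
    abs_of_nonneg (sub_nonneg.2 h)]
  linarith [clock_le_add (P := P) h]

theorem clock_nonneg {P : Set ℝ} (t : ℝ) : 0 ≤ clock P t := measureReal_nonneg

theorem clock_zero {P : Set ℝ} : clock P 0 = 0 := by
  rw [clock, measureReal_def, measure_mono_null (t := {0}) _ (by simp)]
  · simp
  · rintro u ⟨-, hu⟩
    simpa using hu

theorem clock_one {P : Set ℝ} (hP : P ⊆ Icc 0 1) : clock P 1 = volume.real P := by
  rw [clock, inter_eq_left.2 hP]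

theorem clock_le {P : Set ℝ} (hP : P ⊆ Icc 0 1) (t : ℝ) : clock P t ≤ volume.real P :=
  measureReal_mono inter_subset_left (ne_top_of_le_ne_top (by simp) (measure_mono hP))

/-- If `r` is the last time with clock reading `c`, the points of `P` with reading at most `c` form
`P ∩ [0,r]`, of measure `c`. -/
theorem map_clock {P : Set ℝ} (hP : P ⊆ Icc 0 1) :
    (volume.restrict P).map (clock P) = volume.restrict (Icc 0 (volume.real P)) := by
  have hfin : volume P ≠ ⊤ := ne_top_of_le_ne_top (by simp) (measure_mono hP)
  have : IsFiniteMeasure (volume.restrict P) := ⟨by simpa using hfin.lt_top⟩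
  have hm : Measurable (clock P) := continuous_clock.measurable
  refine Measure.ext_of_Iic _ _ fun c => ?_
  rw [Measure.map_apply hm measurableSet_Iic, Measure.restrict_apply (hm measurableSet_Iic),
    Measure.restrict_apply measurableSet_Iic]
  rcases lt_or_ge c 0 with hc | hc
  · have e1 : clock P ⁻¹' Iic c ∩ P = ∅ := by
      ext t
      simp only [mem_inter_iff, mem_preimage, mem_Iic, mem_empty_iff_false, iff_false, not_and]
      exact fun h => absurd (hc.trans_le (clock_nonneg t)) (not_lt.2 h)
    have e2 : Iic c ∩ Icc 0 (volume.real P) = ∅ := by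
      ext t
      simp only [mem_inter_iff, mem_Iic, mem_Icc, mem_empty_iff_false, iff_false]
      intro h
      linarith [h.1, h.2.1]
    rw [e1, e2]
  rcases le_or_gt (volume.real P) c with hc' | hc'
  · rw [inter_eq_right.2 (show P ⊆ clock P ⁻¹' Iic c from fun t _ => (clock_le hP t).trans hc'),
      inter_eq_right.2 (show Icc 0 (volume.real P) ⊆ Iic c from fun t ht => ht.2.trans hc'), Real.volume_Icc, sub_zero,
      ofReal_measureReal hfin]
  · have hcomp : IsCompact (Icc (0 : ℝ) 1 ∩ clock P ⁻¹' Iic c) :=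
      isCompact_Icc.inter_right (isClosed_Iic.preimage continuous_clock)
    obtain ⟨r, hr, hmax⟩ := hcomp.exists_isGreatest
      ⟨0, ⟨le_rfl, zero_le_one⟩, by simpa [clock_zero] using hc⟩
    have hrc : clock P r = c := by
      obtain ⟨q, hq, hqc⟩ := intermediate_value_Icc zero_le_one
        (continuous_clock (P := P)).continuousOn
        (show c ∈ Icc (clock P 0) (clock P 1) by
          rw [clock_zero, clock_one hP]; exact ⟨hc, hc'.le⟩)
      exact le_antisymm hr.2 (hqc.symm.le.trans (clock_mono (hmax ⟨hq, hqc.le⟩)))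
    have e1 : clock P ⁻¹' Iic c ∩ P = P ∩ Icc 0 r := by
      ext t
      refine ⟨fun h => ⟨h.2, (hP h.2).1, hmax ⟨hP h.2, h.1⟩⟩, fun h => ⟨?_, h.1⟩⟩
      exact (clock_mono h.2.2).trans hr.2
    have e2 : Iic c ∩ Icc 0 (volume.real P) = Icc 0 c := by
      ext t
      simp only [mem_inter_iff, mem_Iic, mem_Icc]
      constructor
      · rintro ⟨h1, h2, -⟩
        exact ⟨h2, h1⟩
      · rintro ⟨h1, h2⟩
        exact ⟨h2, h1, h2.trans hc'.le⟩
    rw [e1, e2, Real.volume_Icc, sub_zero, ← hrc, clock, ofReal_measureReal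
      (measure_inter_ne_top_of_right_ne_top (by simp))]

/-! ### The concave rearrangement of a path -/

/-- The times at which a path is positive. -/
def busy (ψ : ℝ → ℝ) : Set ℝ := {t | t ∈ Icc (0 : ℝ) 1 ∧ 0 < ψ t}

theorem busy_subset (ψ : ℝ → ℝ) : busy ψ ⊆ Icc 0 1 := fun _ h => h.1

theorem volume_busy_ne_top (ψ : ℝ → ℝ) : volume (busy ψ) ≠ ⊤ :=
  ne_top_of_le_ne_top (by simp) (measure_mono (busy_subset ψ))

theorem volumeReal_busy_le (ψ : ℝ → ℝ) : volume.real (busy ψ) ≤ 1 := by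
  have := measureReal_mono (μ := volume) (busy_subset ψ) (by simp)
  simpa using this

namespace IsPath

variable {ψ : ℝ → ℝ}

theorem measurableSet_busy (h : IsPath ψ) : MeasurableSet (busy ψ) := by
  have : busy ψ = Icc 0 1 ∩ {t | 0 < extend ψ t} := by
    ext t
    refine and_congr_right fun ht => ?_
    rw [mem_ofPred_eq, extend_eq ht]
  rw [this]
  exact measurableSet_Icc.inter (measurableSet_lt measurable_const
    (measurable_of_boundedVariationOn h.boundedVariationOn_extend))

theorem eq_zero_of_notMem_busy (h : IsPath ψ) {t : ℝ} (ht : t ∈ Icc (0 : ℝ) 1)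
    (hb : t ∉ busy ψ) : ψ t = 0 :=
  le_antisymm (not_lt.1 fun h0 => hb ⟨ht, h0⟩) (h.nonneg t ht)

theorem integral_eq_busy (h : IsPath ψ) : ∫ s in (0 : ℝ)..1, ψ s = ∫ s in busy ψ, ψ s := by
  rw [intervalIntegral.integral_of_le zero_le_one, ← integral_Icc_eq_integral_Ioc]
  exact setIntegral_eq_of_subset_of_forall_sdiff_eq_zero measurableSet_Icc (busy_subset ψ)
    fun t ht => h.eq_zero_of_notMem_busy ht.1 ht.2

theorem integrable_acDeriv (ψ : ℝ → ℝ) : Integrable (acDeriv ψ) :=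
  SignedMeasure.integrable_rnDeriv _ _

theorem measurable_acDeriv (ψ : ℝ → ℝ) : Measurable (acDeriv ψ) :=
  SignedMeasure.measurable_rnDeriv _ _

theorem integral_acDeriv (h : IsPath ψ) {t : ℝ} (ht : t ≤ 1) :
    ∫ s in Icc 0 t, acDeriv ψ s = ∫ s in busy ψ ∩ Icc 0 t, acDeriv ψ s := by
  refine setIntegral_eq_of_subset_of_ae_sdiff_eq_zero measurableSet_Icc.nullMeasurableSet
    inter_subset_right ?_
  filter_upwards [h.acDeriv_ae_eq_zero] with s hs hs'
  have hs1 : s ∈ Icc (0 : ℝ) 1 := ⟨hs'.1.1, hs'.1.2.trans ht⟩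
  exact hs hs1 (h.eq_zero_of_notMem_busy hs1 fun hb => hs'.2 ⟨hb, hs'.1⟩)

/-- Counting all upward singular mass from the start and no downward mass only raises the path; the
rest is the majorization for `P ∩ [0,t]`, whose measure is the clock reading. -/
theorem le_profile_clock (h : IsPath ψ) {y : ℝ → ℝ}
    (hy : ∀ E ⊆ busy ψ, MeasurableSet E →
      ∫ t in E, acDeriv ψ t ≤ ∫ u in (0 : ℝ)..volume.real E, y u)
    {t : ℝ} (ht : t ∈ Icc (0 : ℝ) 1) :
    ψ t ≤ profile (singUp ψ).toReal y (clock (busy ψ) t) := by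
  rw [h.apply_eq ht, h.integral_acDeriv ht.2, profile]
  have h1 := hy (busy ψ ∩ Icc 0 t) inter_subset_left (h.measurableSet_busy.inter measurableSet_Icc)
  have h2 : ((pathMeasure ψ).singularPart volume).toJordanDecomposition.posPart.real (Icc 0 t)
      ≤ (singUp ψ).toReal := measureReal_mono (subset_univ _)
  have h3 : 0 ≤
      ((pathMeasure ψ).singularPart volume).toJordanDecomposition.negPart.real (Icc 0 t) :=
    measureReal_nonneg
  rw [clock]
  linarith

/-- The slope is the rearranged density raised to `-δ`, which `rate_max_le` shows costs nothing. The
downward term is kept in the cost bound so that equality can later force it to vanish. -/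
theorem exists_profile (h : IsPath ψ) {I : ℝ → ℝ≥0∞} (hI : Measurable I) {δ : ℝ} (hδ : 0 < δ)
    (hIδ : I (-δ) = 0) (hz : 0 < ∫ s in (0 : ℝ)..1, ψ s) :
    ∃ y, IsProfile δ (volume.real (busy ψ)) (singUp ψ).toReal y ∧
      profileCost I (singUp ψ).toReal y + thetaDown I * singDown ψ ≤ J I ψ ∧
      ∀ E ⊆ busy ψ, MeasurableSet E →
        ∫ t in E, acDeriv ψ t ≤ ∫ u in (0 : ℝ)..volume.real E, y u := by
  obtain ⟨w, hw, hwi, hwF, hwE⟩ := exists_antitone_rearrangement (volume_busy_ne_top ψ)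
    (measurable_acDeriv ψ) (integrable_acDeriv ψ).integrableOn
  set ℓ := volume.real (busy ψ) with hℓ
  have hℓ1 : ℓ ≤ 1 := volumeReal_busy_le ψ
  have hℓ0 : 0 < ℓ := by
    refine measureReal_nonneg.lt_of_ne' fun h0 => ?_
    have h0' : volume (busy ψ) = 0 := by
      rw [← ofReal_measureReal (volume_busy_ne_top ψ), h0, ENNReal.ofReal_zero]
    rw [h.integral_eq_busy, Measure.restrict_eq_zero.2 h0', integral_zero_measure] at hz
    exact lt_irrefl _ hz
  set y : ℝ → ℝ := fun u => if u < ℓ then max (w u) (-δ) else -δ with hy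
  have hylt : ∀ u, u < ℓ → y u = max (w u) (-δ) := fun u hu => if_pos hu
  have hyge : ∀ u, ℓ ≤ u → y u = -δ := fun u hu => if_neg (not_lt.2 hu)
  have hyi0 : IntegrableOn y (Ioo 0 ℓ) := by
    refine IntegrableOn.congr_fun (f := fun u => max (w u) (-δ))
      (hwi.sup (integrableOn_const (C := -δ) (by simp))) (fun u hu => ?_) measurableSet_Ioo
    rw [hylt u hu.2]
  have hyi : ∀ R, 0 ≤ R → IntervalIntegrable y volume 0 R := by
    intro R hR
    rw [intervalIntegrable_iff_integrableOn_Ioc_of_le hR]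
    have h2 : IntegrableOn y (Icc ℓ R) :=
      (integrableOn_const (C := -δ) (by simp)).congr_fun (fun u hu => (hyge u hu.1).symm)
        measurableSet_Icc
    refine (hyi0.union h2).mono_set fun u hu => ?_
    rcases lt_or_ge u ℓ with h | h
    · exact Or.inl ⟨hu.1, h⟩
    · exact Or.inr ⟨h, hu.2⟩
  have hmaj : ∀ E ⊆ busy ψ, MeasurableSet E →
      ∫ t in E, acDeriv ψ t ≤ ∫ u in (0 : ℝ)..volume.real E, y u := by
    intro E hE hEm
    refine (hwE E hE hEm).trans ?_
    have hle : volume.real E ≤ ℓ := measureReal_mono hE (volume_busy_ne_top ψ)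
    rw [intervalIntegral.integral_of_le measureReal_nonneg, integral_Ioc_eq_integral_Ioo]
    have hsub : Ioo 0 (volume.real E) ⊆ Ioo 0 ℓ := Ioo_subset_Ioo_right hle
    refine setIntegral_mono_on (hwi.mono_set hsub) (hyi0.mono_set hsub) measurableSet_Ioo
      fun u hu => ?_
    rw [hylt u (hsub hu).2]
    exact le_max_left _ _
  refine ⟨y, ⟨hℓ0, hℓ1, ENNReal.toReal_nonneg, ?_, ?_, fun u hu => hyge u hu.le, hyi, ?_⟩, ?_,
    hmaj⟩
  · intro u hu v hv huv
    rcases lt_or_ge v ℓ with h | h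
    · rw [hylt u (huv.trans_lt h), hylt v h]
      exact max_le_max_right _ (hw ⟨hu, huv.trans_lt h⟩ ⟨hv, h⟩ huv)
    · rw [hyge v h]
      rcases lt_or_ge u ℓ with h' | h'
      · rw [hylt u h']
        exact le_max_right _ _
      · rw [hyge u h']
  · intro u _
    rcases lt_or_ge u ℓ with h | h
    · rw [hylt u h]
      exact le_max_right _ _
    · rw [hyge u h]
  · have h1 := h.le_profile_clock hmaj (t := 1) (right_mem_Icc.2 zero_le_one)
    rw [clock_one (busy_subset ψ)] at h1
    exact (h.nonneg 1 (right_mem_Icc.2 zero_le_one)).trans h1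
  · have e1 : ENNReal.ofReal (singUp ψ).toReal = singUp ψ :=
      ENNReal.ofReal_toReal (measure_ne_top _ _)
    have e2 : ∫⁻ u in Ioc (0 : ℝ) 1, I (y u) ≤ ∫⁻ u in Ioo 0 ℓ, I (w u) := by
      rw [← lintegral_indicator measurableSet_Ioc, ← lintegral_indicator measurableSet_Ioo]
      refine lintegral_mono fun u => ?_
      by_cases hu : u ∈ Ioc (0 : ℝ) 1
      · rw [indicator_of_mem hu]
        rcases lt_or_ge u ℓ with h | h
        · rw [indicator_of_mem (show u ∈ Ioo 0 ℓ from ⟨hu.1, h⟩), hylt u h]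
          exact rate_max_le hIδ _
        · rw [hyge u h, hIδ]
          exact zero_le
      · rw [indicator_of_notMem hu]
        exact zero_le
    have e3 : ∫⁻ s in busy ψ, I (acDeriv ψ s)
        ≤ ∫⁻ s in Icc (0 : ℝ) 1, if 0 < ψ s then I (acDeriv ψ s) else 0 := by
      rw [← lintegral_indicator h.measurableSet_busy, ← lintegral_indicator measurableSet_Icc]
      refine lintegral_mono fun s => ?_
      by_cases hs : s ∈ busy ψ
      · rw [indicator_of_mem hs, indicator_of_mem hs.1, if_pos hs.2]
      · rw [indicator_of_notMem hs]
        exact zero_le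
    rw [hwF I hI] at e2
    rw [profileCost, J, e1, iInf_nonpos_eq_zero hδ hIδ]
    calc _ = (∫⁻ u in Ioc (0 : ℝ) 1, I (y u)) + thetaDown I * singDown ψ
          + thetaUp I * singUp ψ := by ring
      _ ≤ _ := add_le_add (add_le_add (e2.trans e3) le_rfl) le_rfl

/-- Comparison of the areas, with the equality case. -/
theorem integral_le_profileArea (h : IsPath ψ) (hz : 0 < ∫ s in (0 : ℝ)..1, ψ s) {δ : ℝ}
    {y : ℝ → ℝ} (hp : IsProfile δ (volume.real (busy ψ)) (singUp ψ).toReal y)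
    (hy : ∀ E ⊆ busy ψ, MeasurableSet E →
      ∫ t in E, acDeriv ψ t ≤ ∫ u in (0 : ℝ)..volume.real E, y u) :
    ∫ s in (0 : ℝ)..1, ψ s ≤ profileArea (volume.real (busy ψ)) (singUp ψ).toReal y ∧
      (∫ s in (0 : ℝ)..1, ψ s = profileArea (volume.real (busy ψ)) (singUp ψ).toReal y →
        ∀ᵐ t, t ∈ busy ψ → ψ t = profile (singUp ψ).toReal y (clock (busy ψ) t)) := by
  set Φ := profile (singUp ψ).toReal y with hΦ
  set ℓ := volume.real (busy ψ) with hℓ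
  have hcont : ContinuousOn (fun t => Φ (clock (busy ψ) t)) (Icc 0 1) :=
    hp.continuousOn.comp continuous_clock.continuousOn fun t _ =>
      ⟨clock_nonneg t, (clock_le (busy_subset ψ) t).trans (volumeReal_busy_le ψ)⟩
  have hΦi : IntegrableOn (fun t => Φ (clock (busy ψ) t)) (busy ψ) :=
    (hcont.integrableOn_compact isCompact_Icc).mono_set (busy_subset ψ)
  -- A non-integrable `ψ` would have integral `0` by convention, against `hz`.
  have hψi : IntegrableOn ψ (busy ψ) := by
    by_contra hn
    rw [h.integral_eq_busy, integral_undef hn] at hz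
    exact lt_irrefl _ hz
  have harea : profileArea ℓ (singUp ψ).toReal y = ∫ t in busy ψ, Φ (clock (busy ψ) t) := by
    have hsm : AEStronglyMeasurable Φ ((volume.restrict (busy ψ)).map (clock (busy ψ))) := by
      rw [map_clock (busy_subset ψ)]
      exact ((hp.continuousOn.mono (Icc_subset_Icc_right hp.length_le)).integrableOn_compact
        isCompact_Icc).aestronglyMeasurable
    rw [← integral_map continuous_clock.aemeasurable hsm, map_clock (busy_subset ψ),
      integral_Icc_eq_integral_Ioc, ← intervalIntegral.integral_of_le measureReal_nonneg]
    rfl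
  have hle : ∀ t ∈ busy ψ, ψ t ≤ Φ (clock (busy ψ) t) := fun t ht =>
    h.le_profile_clock hy ht.1
  rw [h.integral_eq_busy, harea]
  refine ⟨setIntegral_mono_on hψi hΦi h.measurableSet_busy hle, fun heq => ?_⟩
  have := (integral_eq_iff_of_ae_le hψi hΦi
    ((ae_restrict_iff' h.measurableSet_busy).2 (Eventually.of_forall hle))).1 heq
  exact (ae_restrict_iff' h.measurableSet_busy).1 this

end IsPath

/-! ### Paths that attain their concave rearrangement -/

theorem ConcaveOn.pos_of_nonneg_of_pos {f : ℝ → ℝ} {l c v : ℝ} (hf : ConcaveOn ℝ (Icc 0 l) f)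
    (h0 : ∀ x ∈ Icc 0 l, 0 ≤ f x) (hc : c ∈ Icc 0 l) (hfc : 0 < f c) (hv : v ∈ Ioo 0 l) :
    0 < f v := by
  have h0l : 0 ≤ l := hv.1.le.trans hv.2.le
  rcases lt_trichotomy v c with h | rfl | h
  · have hc0 : 0 < c := hv.1.trans h
    have := hf.2 (left_mem_Icc.2 h0l) hc (sub_nonneg.2 ((div_le_one hc0).2 h.le))
      (div_nonneg hv.1.le hc0.le) (sub_add_cancel _ _)
    simp only [smul_eq_mul, mul_zero, zero_add, div_mul_cancel₀ _ hc0.ne'] at this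
    have h1 := mul_nonneg (sub_nonneg.2 ((div_le_one hc0).2 h.le)) (h0 0 (left_mem_Icc.2 h0l))
    have h2 := mul_pos (div_pos hv.1 hc0) hfc
    linarith
  · exact hfc
  · have hd : 0 < l - c := by linarith [hv.2]
    have hq : 0 ≤ (v - c) / (l - c) := div_nonneg (by linarith) hd.le
    have hq1 : (v - c) / (l - c) < 1 := (div_lt_one hd).2 (by linarith [hv.2])
    have := hf.2 hc (right_mem_Icc.2 h0l) (sub_nonneg.2 hq1.le) hq (sub_add_cancel _ _)
    have e : (1 - (v - c) / (l - c)) • c + ((v - c) / (l - c)) • l = v := by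
      simp only [smul_eq_mul]
      field_simp
      ring
    rw [e] at this
    simp only [smul_eq_mul] at this
    have h1 := mul_nonneg hq (h0 l (right_mem_Icc.2 h0l))
    have h2 := mul_pos (sub_pos.2 hq1) hfc
    linarith

/-- If two clock readings agree, the set is null in between. -/
theorem inter_Icc_ae_eq_of_clock_eq {P : Set ℝ} (hP : MeasurableSet P) {r t : ℝ} (hrt : r ≤ t)
    (h : clock P r = clock P t) : (P ∩ Icc 0 r : Set ℝ) =ᵐ[volume] (P ∩ Icc 0 t : Set ℝ) := by
  have hfin : ∀ x, volume (P ∩ Icc 0 x) ≠ ⊤ := fun x =>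
    measure_inter_ne_top_of_right_ne_top (by simp)
  refine ae_eq_of_subset_of_measure_ge (inter_subset_inter_right _ (Icc_subset_Icc_right hrt)) ?_
    (hP.inter measurableSet_Icc).nullMeasurableSet (hfin t)
  rw [← ofReal_measureReal (hfin t), ← ofReal_measureReal (hfin r)]
  exact ENNReal.ofReal_le_ofReal h.ge

/-- If the clock advances between `s` and `t`, almost every property of points of the set is
realized in between. -/
theorem exists_mem_of_clock_lt {P A : Set ℝ} (hA : ∀ᵐ t, t ∈ P → t ∈ A) {s t : ℝ}
    (h : clock P s < clock P t) : ∃ p ∈ A, s < p ∧ p ≤ t := by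
  by_contra! hn
  refine absurd h (not_lt.2 ?_)
  refine ENNReal.toReal_mono (measure_inter_ne_top_of_right_ne_top (by simp))
    (measure_mono_ae ?_)
  filter_upwards [hA] with u hu hut
  refine ⟨hut.1, hut.2.1, ?_⟩
  by_contra! hlt
  exact absurd hut.2.2 (not_le.2 (hn u (hu hut.1) hlt))

/-- Write `ψ = S + Y`, with `S ≤ a` the upward singular mass so far and `Y ≤ Φ ∘ τ - a` the
absolutely continuous part. Equality of the sums forces both to be equalities at almost every point
of `P`; monotonicity of `S` and continuity of `Y` spread them over `(T₀,1]`. Here `T₀` is the last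
time with clock reading `0` and `T₁` the first with reading `ℓ`. -/
theorem IsPath.structure_of_eq {ψ : ℝ → ℝ} (h : IsPath ψ) {δ : ℝ} {y : ℝ → ℝ}
    (hp : IsProfile δ (volume.real (busy ψ)) (singUp ψ).toReal y)
    (hy : ∀ E ⊆ busy ψ, MeasurableSet E →
      ∫ t in E, acDeriv ψ t ≤ ∫ u in (0 : ℝ)..volume.real E, y u)
    (heq : ∀ᵐ t, t ∈ busy ψ → ψ t = profile (singUp ψ).toReal y (clock (busy ψ) t))
    (hdown : singDown ψ = 0) :
    ∃ T₀ T₁ : ℝ, 0 ≤ T₀ ∧ T₀ < T₁ ∧ T₁ ≤ 1 ∧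
      (∀ t ∈ Ioo T₀ T₁, 0 < ψ t) ∧
      (∀ t ∈ Icc (0 : ℝ) 1 \ Icc T₀ T₁, ψ t = 0) ∧
      ConcaveOn ℝ (Icc T₀ T₁) ψ ∧
      (∀ t ∈ Ioc T₀ T₁, ContinuousWithinAt ψ (Icc 0 1) t) := by
  set P := busy ψ with hPdef
  set a := (singUp ψ).toReal with ha
  set Φ := profile a y with hΦ
  set τ := clock P with hτ
  set ℓ := volume.real P with hℓ
  have hPm : MeasurableSet P := h.measurableSet_busy
  have hP1 : P ⊆ Icc 0 1 := busy_subset ψ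
  have hℓ0 : 0 < ℓ := hp.length_pos
  have hτm : Monotone τ := clock_mono
  have hτc : Continuous τ := continuous_clock
  have hτ1 : τ 1 = ℓ := clock_one hP1
  have hτ01 : ∀ t, τ t ∈ Icc 0 ℓ := fun t => ⟨clock_nonneg t, clock_le hP1 t⟩
  have hΦτ : ContinuousOn (fun t => Φ (τ t)) (Icc 0 1) :=
    hp.continuousOn.comp hτc.continuousOn fun t _ =>
      ⟨(hτ01 t).1, (hτ01 t).2.trans hp.length_le⟩
  set S : ℝ → ℝ := fun t =>
    ((pathMeasure ψ).singularPart volume).toJordanDecomposition.posPart.real (Icc 0 t) with hS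
  set Y : ℝ → ℝ := fun t => ∫ s in P ∩ Icc 0 t, acDeriv ψ s with hY
  have hSm : Monotone S := fun s t hst => measureReal_mono (Icc_subset_Icc_right hst)
  have hSa : ∀ t, S t ≤ a := fun t => measureReal_mono (subset_univ _)
  have hYle : ∀ t, Y t ≤ Φ (τ t) - a := by
    intro t
    have := hy (P ∩ Icc 0 t) inter_subset_left (hPm.inter measurableSet_Icc)
    rw [hΦ, profile, add_sub_cancel_left]
    exact this
  have hψ : ∀ t ∈ Icc (0 : ℝ) 1, ψ t = S t + Y t := by
    intro t ht
    have h0 : ((pathMeasure ψ).singularPart volume).toJordanDecomposition.negPart.real (Icc 0 t)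
        = 0 := by
      rw [measureReal_def, measure_mono_null (subset_univ _) hdown, ENNReal.toReal_zero]
    rw [h.apply_eq ht, h.integral_acDeriv ht.2, h0, sub_zero]
  have hYc : ContinuousOn Y (Icc 0 1) := by
    have hc := intervalIntegral.continuous_primitive
      (fun p q => (IsPath.integrable_acDeriv ψ).intervalIntegrable (a := p) (b := q)) 0
    refine hc.continuousOn.congr fun t ht => ?_
    simp only [hY]
    rw [intervalIntegral.integral_of_le ht.1, ← integral_Icc_eq_integral_Ioc]
    exact (h.integral_acDeriv ht.2).symm
  set A : Set ℝ := {t | t ∈ Icc (0 : ℝ) 1 ∧ 0 < ψ t ∧ S t = a ∧ Y t = Φ (τ t) - a} with hAdef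
  have hA : ∀ᵐ t, t ∈ P → t ∈ A := by
    filter_upwards [heq] with t ht htP
    have h1 := ht htP
    rw [hψ t htP.1] at h1
    have h2 := hSa t
    have h3 := hYle t
    exact ⟨htP.1, htP.2, by linarith, by linarith⟩
  obtain ⟨T₀, hT₀, hT₀max⟩ := (isCompact_Icc.inter_right
    (isClosed_Iic.preimage hτc) : IsCompact (Icc (0 : ℝ) 1 ∩ τ ⁻¹' Iic 0)).exists_isGreatest
    ⟨0, ⟨le_rfl, zero_le_one⟩, clock_zero.le⟩
  obtain ⟨T₁, hT₁, hT₁min⟩ := (isCompact_Icc.inter_right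
    (isClosed_Ici.preimage hτc) : IsCompact (Icc (0 : ℝ) 1 ∩ τ ⁻¹' Ici ℓ)).exists_isLeast
    ⟨1, ⟨zero_le_one, le_rfl⟩, hτ1.ge⟩
  have hτT₀ : τ T₀ = 0 := le_antisymm hT₀.2 (hτ01 _).1
  have hτT₁ : τ T₁ = ℓ := le_antisymm (hτ01 _).2 hT₁.2
  have hT : T₀ < T₁ := by
    by_contra! hle
    have := hτm hle
    linarith
  have hτpos : ∀ t ∈ Ioc T₀ 1, 0 < τ t := by
    intro t ht
    by_contra! hle
    exact absurd (hT₀max ⟨⟨hT₀.1.1.trans ht.1.le, ht.2⟩, hle⟩) (not_le.2 ht.1)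
  have hτlt : ∀ t, T₀ < t → t < T₁ → τ t < ℓ := by
    intro t h0 h1
    by_contra! hle
    exact absurd (hT₁min ⟨⟨hT₀.1.1.trans h0.le, h1.le.trans hT₁.1.2⟩, hle⟩) (not_le.2 h1)
  have hSeq : ∀ t ∈ Ioc T₀ 1, S t = a := by
    intro t ht
    obtain ⟨p, hpA, -, hpt⟩ := exists_mem_of_clock_lt hA (s := T₀) (t := t)
      (hτT₀.trans_lt (hτpos t ht))
    exact le_antisymm (hSa t) (hpA.2.2.1.ge.trans (hSm hpt))
  have hYeq : ∀ t ∈ Ioc T₀ 1, Y t = Φ (τ t) - a := by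
    intro t ht
    have ht01 : t ∈ Icc (0 : ℝ) 1 := ⟨hT₀.1.1.trans ht.1.le, ht.2⟩
    -- At the first time `r` with the reading of `t`, the clock has just advanced, so `r` is a limit
    -- of points of `A`. Between `r` and `t` the set `P` is null and `Y` is constant.
    obtain ⟨r, hr, hrmin⟩ := (isCompact_Icc.inter_right
      (isClosed_Ici.preimage hτc) : IsCompact (Icc (0 : ℝ) 1 ∩ τ ⁻¹' Ici (τ t))).exists_isLeast
      ⟨t, ht01, le_refl (τ t)⟩
    have hrt : r ≤ t := hrmin ⟨ht01, le_refl (τ t)⟩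
    have hτr : τ r = τ t := le_antisymm (hτm hrt) hr.2
    have hcl : IsClosed (Icc (0 : ℝ) 1 ∩ (fun x => Y x - (Φ (τ x) - a)) ⁻¹' {0}) :=
      (hYc.sub (hΦτ.sub continuousOn_const)).preimage_isClosed_of_isClosed isClosed_Icc
        isClosed_singleton
    have hAcl : A ⊆ Icc (0 : ℝ) 1 ∩ (fun x => Y x - (Φ (τ x) - a)) ⁻¹' {0} := fun x hx =>
      ⟨hx.1, by simp [hx.2.2.2]⟩
    have hrA : r ∈ closure A := by
      rw [Metric.mem_closure_iff]
      intro ε hε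
      have hlt : τ (max 0 (r - ε / 2)) < τ r := by
        rcases eq_or_lt_of_le hr.1.1 with h0 | h0
        · have := hτpos t ht
          rw [← hτr, ← h0, hτ, clock_zero] at this
          exact absurd this (lt_irrefl _)
        · by_contra! hle
          have hm : max 0 (r - ε / 2) < r := max_lt h0 (by linarith)
          have := hrmin ⟨⟨le_max_left _ _, hm.le.trans hr.1.2⟩,
            show τ t ≤ _ from hτr.symm.le.trans hle⟩
          exact absurd this (not_le.2 hm)
      obtain ⟨p, hpA, hp1, hp2⟩ := exists_mem_of_clock_lt hA hlt
      refine ⟨p, hpA, ?_⟩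
      have := (le_max_right 0 (r - ε / 2)).trans_lt hp1
      rw [Real.dist_eq, abs_of_nonneg (by linarith)]
      linarith
    have hrY : Y r = Φ (τ r) - a := by
      have := (hcl.closure_subset_iff.2 hAcl hrA).2
      simpa [sub_eq_zero] using this
    have : Y t = Y r := setIntegral_congr_set (inter_Icc_ae_eq_of_clock_eq hPm hrt hτr).symm
    rw [this, hrY, hτr]
  have hψeq : ∀ t ∈ Ioc T₀ 1, ψ t = Φ (τ t) := by
    intro t ht
    rw [hψ t ⟨hT₀.1.1.trans ht.1.le, ht.2⟩, hSeq t ht, hYeq t ht]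
    ring
  have hconc : ConcaveOn ℝ (Icc 0 ℓ) Φ := hp.concaveOn.subset Icc_subset_Ici_self (convex_Icc _ _)
  have hΦpos : ∀ v ∈ Ioo 0 ℓ, 0 < Φ v := by
    obtain ⟨p, hpA, hp1, -⟩ := exists_mem_of_clock_lt hA (s := T₀) (t := T₁)
      (by rw [← hτ, hτT₀, hτT₁]; exact hℓ0)
    intro v hv
    refine ConcaveOn.pos_of_nonneg_of_pos hconc (fun x hx => hp.nonneg hx) (hτ01 p) ?_ hv
    rw [← hψeq p ⟨hp1, hpA.1.2⟩]
    exact hpA.2.1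
  have hpos : ∀ t ∈ Ioo T₀ T₁, 0 < ψ t := by
    intro t ht
    have ht1 : t ∈ Ioc T₀ 1 := ⟨ht.1, ht.2.le.trans hT₁.1.2⟩
    rw [hψeq t ht1]
    exact hΦpos _ ⟨hτpos t ht1, hτlt t ht.1 ht.2⟩
  -- Positivity puts `(T₀,T₁)` inside `P`, so the clock runs at unit speed there.
  have hτeq : ∀ t ∈ Icc T₀ T₁, τ t = t - T₀ := by
    intro t ht
    refine le_antisymm ?_ ?_
    · have := clock_le_add (P := P) ht.1
      rw [← hτ, hτT₀] at this
      linarith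
    · have hsub : Ioo T₀ t ⊆ P ∩ Icc 0 t := fun u hu =>
        ⟨⟨⟨hT₀.1.1.trans hu.1.le, hu.2.le.trans (ht.2.trans hT₁.1.2)⟩,
          hpos u ⟨hu.1, hu.2.trans_le ht.2⟩⟩, hT₀.1.1.trans hu.1.le, hu.2.le⟩
      have := measureReal_mono (μ := volume) hsub
        (measure_inter_ne_top_of_right_ne_top (by simp))
      rwa [Real.volume_real_Ioo_of_le ht.1] at this
  have hcontat : ∀ t ∈ Ioc T₀ T₁, ContinuousWithinAt ψ (Icc 0 1) t := by
    intro t ht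
    have ht1 : t ∈ Ioc T₀ 1 := ⟨ht.1, ht.2.trans hT₁.1.2⟩
    refine (hΦτ t ⟨hT₀.1.1.trans ht1.1.le, ht1.2⟩).congr_of_eventuallyEq ?_ (hψeq t ht1)
    filter_upwards [self_mem_nhdsWithin, mem_nhdsWithin_of_mem_nhds (Ioi_mem_nhds ht.1)]
      with s hs hs' using hψeq s ⟨hs', hs.2⟩
  -- The value at `T₀` comes from right continuity alone; this leaves room for a jump of size `a`.
  have hψT₀ : ψ T₀ = Φ 0 := by
    have h1 : Tendsto ψ (𝓝[>] T₀) (𝓝 (ψ T₀)) :=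
      (h.right_continuous T₀ ⟨hT₀.1.1, hT.trans_le hT₁.1.2⟩).mono Ioi_subset_Ici_self
    have h2 : Tendsto (fun t => Φ (τ t)) (𝓝[>] T₀) (𝓝 (Φ (τ T₀))) := by
      rw [← nhdsWithin_Ioc_eq_nhdsGT (hT.trans_le hT₁.1.2)]
      exact (hΦτ T₀ hT₀.1).mono fun u hu => ⟨hT₀.1.1.trans hu.1.le, hu.2⟩
    rw [hτT₀] at h2
    refine tendsto_nhds_unique h1 (h2.congr' ?_)
    filter_upwards [Ioc_mem_nhdsGT (hT.trans_le hT₁.1.2)] with t ht using (hψeq t ht).symm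
  have hψΦ : ∀ t ∈ Icc T₀ T₁, ψ t = Φ (t - T₀) := by
    intro t ht
    rcases eq_or_lt_of_le ht.1 with rfl | h0
    · rw [hψT₀, sub_self]
    · rw [hψeq t ⟨h0, ht.2.trans hT₁.1.2⟩, hτeq t ht]
  refine ⟨T₀, T₁, hT₀.1.1, hT, hT₁.1.2, hpos, ?_, ?_, hcontat⟩
  · rintro t ⟨ht, htn⟩
    rcases lt_or_ge t T₀ with hlt | hge
    -- By right continuity a positive value before `T₀` would persist on an interval, and the clock
    -- would be positive at `T₀`.
    · by_contra hne
      have hψt : 0 < ψ t := lt_of_le_of_ne (h.nonneg t ht) (Ne.symm hne)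
      have hev : ∀ᶠ s in 𝓝[≥] t, 0 < ψ s :=
        (h.right_continuous t ⟨ht.1, hlt.trans_le hT₀.1.2⟩).eventually (lt_mem_nhds hψt)
      obtain ⟨u, hu, hsub⟩ := (mem_nhdsGE_iff_exists_Ico_subset' hlt).1
        (inter_mem hev (Ico_mem_nhdsGE hlt))
      have hsub' : Ico t u ⊆ P ∩ Icc 0 T₀ := fun s hs =>
        ⟨⟨⟨ht.1.trans hs.1, (hsub hs).2.2.le.trans hT₀.1.2⟩, (hsub hs).1⟩,
          ht.1.trans hs.1, (hsub hs).2.2.le⟩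
      have := measureReal_mono (μ := volume) hsub'
        (measure_inter_ne_top_of_right_ne_top (by simp))
      rw [Real.volume_real_Ico_of_le (le_of_lt hu)] at this
      have h2 : volume.real (P ∩ Icc 0 T₀) = 0 := hτT₀
      rw [h2] at this
      exact absurd (mem_Ioi.1 hu) (not_lt.2 (by linarith))
    · have hgt : T₁ < t := by
        by_contra! hle
        exact htn ⟨hge, hle⟩
      -- After `T₁` the path is constant; a positive constant would put `(T₁,1]` in `P`, although
      -- the clock has stopped.
      have hval : ∀ s ∈ Ioc T₁ 1, ψ s = Φ ℓ := fun s hs => by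
        rw [hψeq s ⟨hT.trans hs.1, hs.2⟩,
          le_antisymm (hτ01 s).2 (hτT₁.symm.le.trans (hτm hs.1.le))]
      rw [hval t ⟨hgt, ht.2⟩]
      by_contra hne
      have hΦℓ : 0 < Φ ℓ := lt_of_le_of_ne hp.end_nonneg (Ne.symm hne)
      have hsub : Ioc T₁ 1 ⊆ P := fun s hs =>
        ⟨⟨hT₁.1.1.trans hs.1.le, hs.2⟩, by rw [hval s hs]; exact hΦℓ⟩
      have hae := inter_Icc_ae_eq_of_clock_eq hPm hT₁.1.2 (hτT₁.trans hτ1.symm)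
      have hnull : volume (Ioc T₁ 1) = 0 := by
        refine measure_mono_null (t := (P ∩ Icc 0 1) \ (P ∩ Icc 0 T₁)) (fun s hs => ?_)
          (ae_le_set.1 hae.symm.le)
        exact ⟨⟨hsub hs, hT₁.1.1.trans hs.1.le, hs.2⟩, fun hs' => absurd hs'.2.2 (not_le.2 hs.1)⟩
      rw [Real.volume_Ioc, ENNReal.ofReal_eq_zero] at hnull
      linarith [ht.2]
  · have hc := hp.concaveOn.subset (show Icc 0 (T₁ - T₀) ⊆ Ici 0 from Icc_subset_Ici_self)
      (convex_Icc _ _)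
    refine ⟨convex_Icc _ _, fun x hx z hz p q hp0 hq0 hpq => ?_⟩
    have := hc.2 (x := x - T₀) ⟨by linarith [hx.1], by linarith [hx.2]⟩ (y := z - T₀)
      ⟨by linarith [hz.1], by linarith [hz.2]⟩ hp0 hq0 hpq
    have e : p • (x - T₀) + q • (z - T₀) = p • x + q • z - T₀ := by
      simp only [smul_eq_mul]
      linear_combination (-T₀) * hpq
    rw [e] at this
    rw [hψΦ x hx, hψΦ z hz, hψΦ _ (convex_Icc T₀ T₁ hx hz hp0 hq0 hpq)]
    exact this

/-! ### Compactness of antitone functions -/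

/-- **Helly's selection theorem** for antitone functions on the line. -/
theorem exists_subseq_tendsto_antitone {f : ℕ → ℝ → ℝ} (hf : ∀ n, Antitone (f n)) {B : ℝ → ℝ}
    (hB : ∀ n x, |f n x| ≤ B x) :
    ∃ g : ℝ → ℝ, Antitone g ∧ ∃ φ : ℕ → ℕ, StrictMono φ ∧ ∃ C : Set ℝ, C.Countable ∧
      ∀ x ∉ C, Tendsto (fun n => f (φ n) x) atTop (𝓝 (g x)) := by
  have hcomp : IsCompact (univ.pi fun q : ℚ => Icc (-B q) (B q)) :=
    isCompact_univ_pi fun q => isCompact_Icc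
  obtain ⟨L, -, φ, hφ, hL⟩ := hcomp.tendsto_subseq (x := fun n (q : ℚ) => f n q)
    fun n q _ => abs_le.1 (hB n q)
  rw [tendsto_pi_nhds] at hL
  have hLq : ∀ q : ℚ, Tendsto (fun n => f (φ n) q) atTop (𝓝 (L q)) := hL
  have hLanti : ∀ p q : ℚ, p ≤ q → L q ≤ L p := fun p q hpq =>
    le_of_tendsto_of_tendsto' (hLq q) (hLq p) fun n => hf _ (by exact_mod_cast hpq)
  -- The limit on the rationals, made left continuous; monotonicity squeezes the sequence to `g`
  -- wherever `g` is continuous.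
  set g : ℝ → ℝ := fun x => sInf (L '' {q : ℚ | (q : ℝ) < x}) with hg
  have hne : ∀ x : ℝ, (L '' {q : ℚ | (q : ℝ) < x}).Nonempty := fun x =>
    let ⟨q, hq⟩ := exists_rat_lt x
    ⟨L q, q, hq, rfl⟩
  have hbdd : ∀ x : ℝ, BddBelow (L '' {q : ℚ | (q : ℝ) < x}) := by
    intro x
    obtain ⟨r, hr⟩ := exists_rat_gt x
    refine ⟨L r, ?_⟩
    rintro _ ⟨q, hq, rfl⟩
    exact hLanti q r (by exact_mod_cast (lt_trans hq hr).le)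
  have hganti : Antitone g := fun x z hxz =>
    csInf_le_csInf (hbdd z) (hne x) (image_mono fun q hq => lt_of_lt_of_le hq hxz)
  refine ⟨g, hganti, φ, hφ, {x | ¬ ContinuousAt g x}, hganti.countable_not_continuousAt,
    fun x hx => ?_⟩
  have hx : ContinuousAt g x := not_not.1 hx
  refine tendsto_order.2 ⟨fun c hc => ?_, fun c hc => ?_⟩
  · have hev : ∀ᶠ z in 𝓝[>] x, c < g z :=
      (hx.tendsto.mono_left nhdsWithin_le_nhds).eventually (lt_mem_nhds hc)
    obtain ⟨z, hz, hxz⟩ := (hev.and self_mem_nhdsWithin).exists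
    obtain ⟨q, hxq, hqz⟩ := exists_rat_btwn (show x < z from hxz)
    have hq : c < L q := hz.trans_le (csInf_le (hbdd z) ⟨q, hqz, rfl⟩)
    filter_upwards [(hLq q).eventually (lt_mem_nhds hq)] with n hn
    exact hn.trans_le (hf _ hxq.le)
  · obtain ⟨_, ⟨q, hq, rfl⟩, hqc⟩ := exists_lt_of_csInf_lt (hne x) hc
    filter_upwards [(hLq q).eventually (gt_mem_nhds hqc)] with n hn
    exact (hf _ (le_of_lt hq)).trans_lt hn

/-- The logarithm carries the half-line to the line, so the bound may blow up at `0`. -/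
theorem exists_subseq_tendsto_antitoneOn {f : ℕ → ℝ → ℝ} (hf : ∀ n, AntitoneOn (f n) (Ioi 0))
    {B : ℝ → ℝ} (hB : ∀ n x, 0 < x → |f n x| ≤ B x) :
    ∃ g : ℝ → ℝ, AntitoneOn g (Ioi 0) ∧ ∃ φ : ℕ → ℕ, StrictMono φ ∧ ∃ C : Set ℝ, C.Countable ∧
      ∀ x ∉ C, 0 < x → Tendsto (fun n => f (φ n) x) atTop (𝓝 (g x)) := by
  obtain ⟨g, hg, φ, hφ, C, hC, hlim⟩ := exists_subseq_tendsto_antitone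
    (f := fun n x => f n (Real.exp x)) (B := fun x => B (Real.exp x))
    (fun n x z hxz => hf n (Real.exp_pos x) (Real.exp_pos z) (Real.exp_le_exp.2 hxz))
    (fun n x => hB n _ (Real.exp_pos x))
  refine ⟨fun x => g (Real.log x), fun x hx z hz hxz => hg (Real.log_le_log hx hxz), φ, hφ,
    Real.exp '' C, hC.image _, fun x hxC hx => ?_⟩
  have := hlim (Real.log x) fun h => hxC ⟨_, h, Real.exp_log hx⟩
  simpa only [Real.exp_log hx] using this

/-! ### Limits of profiles -/

theorem add_le_of_tendsto_of_le_liminf {u v c : ℕ → ℝ≥0∞} {U X K : ℝ≥0∞}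
    (hu : Tendsto u atTop (𝓝 U)) (hv : X ≤ liminf v atTop) (hc : Tendsto c atTop (𝓝 K))
    (h : ∀ n, u n + v n ≤ c n) : U + X ≤ K := by
  have hw : Tendsto (fun n => ⨅ i, v (i + n)) atTop (𝓝 (liminf v atTop)) := by
    rw [liminf_eq_iSup_iInf_of_nat']
    exact tendsto_atTop_iSup fun m n hmn => le_iInf fun i => by
      have := iInf_le (fun i => v (i + m)) (i + (n - m))
      rwa [add_assoc, Nat.sub_add_cancel hmn] at this
  refine (add_le_add le_rfl hv).trans (le_of_tendsto_of_tendsto' (hu.add hw) hc fun n => ?_)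
  refine le_trans ?_ (h n)
  gcongr
  simpa using iInf_le (fun i => v (i + n)) 0

theorem intervalIntegrable_of_tail {δ ℓ : ℝ} {y : ℝ → ℝ} (hℓ : ℓ ≤ 1)
    (htail : ∀ u, ℓ < u → y u = -δ) (hint : IntegrableOn y (Ioc 0 1)) (R : ℝ) (hR : 0 ≤ R) :
    IntervalIntegrable y volume 0 R := by
  rw [intervalIntegrable_iff_integrableOn_Ioc_of_le hR]
  have h2 : IntegrableOn y (Ioc 1 R) :=
    IntegrableOn.congr_fun (f := fun _ => -δ) (integrableOn_const (by simp))
      (fun u hu => (htail u (hℓ.trans_lt hu.1)).symm) measurableSet_Ioc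
  refine (hint.union h2).mono_set fun u hu => ?_
  rcases le_or_gt u 1 with h | h
  · exact Or.inl ⟨hu.1, h⟩
  · exact Or.inr ⟨h, hu.2⟩

namespace IsProfile

variable {δ ℓ a M : ℝ} {y : ℝ → ℝ}

theorem neg_le_profile (h : IsProfile δ ℓ a y) {t : ℝ} (ht : 0 ≤ t) : -δ * t ≤ profile a y t := by
  have h1 := intervalIntegral.integral_mono_on_of_le_Ioo ht
    (intervalIntegrable_const (c := -δ) (μ := volume)) (h.integrable t ht)
    (fun u hu => h.le_slope u hu.1)
  have h0 := h.start_nonneg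
  simp only [intervalIntegral.integral_const, smul_eq_mul, sub_zero] at h1
  rw [profile]
  linarith

theorem ofReal_integral_le {c t : ℝ} (ht : 0 ≤ t) :
    ENNReal.ofReal (∫ u in (0 : ℝ)..t, c * y u) ≤ ∫⁻ u in Ioc 0 t, ENNReal.ofReal (c * y u) := by
  rw [intervalIntegral.integral_of_le ht]
  by_cases hi : Integrable (fun u => c * y u) (volume.restrict (Ioc 0 t))
  · refine (ENNReal.ofReal_le_ofReal (integral_mono hi hi.pos_part fun u => le_max_left _ _)).trans
      ?_
    rw [ofReal_integral_eq_lintegral_ofReal hi.pos_part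
      (Eventually.of_forall fun u => le_max_right _ _)]
    refine lintegral_mono fun u => ?_
    rcases le_total (c * y u) 0 with h | h
    · simp [max_eq_right h]
    · simp [max_eq_left h]
  · rw [integral_undef hi]
    simp

theorem profile_le (ha : a ≤ M) (hM : ∫⁻ u in Ioc (0 : ℝ) 1, ENNReal.ofReal (y u) ≤
    ENNReal.ofReal M) (hM0 : 0 ≤ M) {t : ℝ} (ht : t ∈ Icc (0 : ℝ) 1) :
    profile a y t ≤ 2 * M := by
  have h1 := ofReal_integral_le (y := y) (c := 1) ht.1
  simp only [one_mul] at h1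
  have h2 := (h1.trans (lintegral_mono_set (Ioc_subset_Ioc_right ht.2))).trans hM
  rw [ENNReal.ofReal_le_ofReal_iff hM0] at h2
  rw [profile]
  linarith

/-- An antitone slope is at least `y u` on all of `(0,u]`, so the bound on its positive mass gives
`u * y u ≤ M`. -/
theorem slope_le (h : IsProfile δ ℓ a y) (hM : ∫⁻ u in Ioc (0 : ℝ) 1, ENNReal.ofReal (y u) ≤
    ENNReal.ofReal M) (hM0 : 0 ≤ M) {u : ℝ} (hu : u ∈ Ioc (0 : ℝ) 1) : y u ≤ M / u := by
  rw [le_div_iff₀ hu.1]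
  have h1 : ENNReal.ofReal (y u) * ENNReal.ofReal u ≤ ENNReal.ofReal M := by
    refine le_trans ?_ hM
    calc ENNReal.ofReal (y u) * ENNReal.ofReal u = ∫⁻ _ in Ioc 0 u, ENNReal.ofReal (y u) := by
          simp
      _ ≤ ∫⁻ v in Ioc 0 u, ENNReal.ofReal (y v) :=
          setLIntegral_mono' measurableSet_Ioc fun v hv =>
            ENNReal.ofReal_le_ofReal (h.antitoneOn hv.1 hu.1 hv.2)
      _ ≤ _ := lintegral_mono_set (Ioc_subset_Ioc_right hu.2)
  rcases le_or_gt (y u) 0 with h0 | h0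
  · nlinarith [hu.1]
  · rwa [← ENNReal.ofReal_mul h0.le, ENNReal.ofReal_le_ofReal_iff hM0] at h1

theorem abs_slope_le (h : IsProfile δ ℓ a y) (hδ : 0 < δ)
    (hM : ∫⁻ u in Ioc (0 : ℝ) 1, ENNReal.ofReal (y u) ≤ ENNReal.ofReal M) (hM0 : 0 ≤ M)
    {u : ℝ} (hu : 0 < u) : |y u| ≤ δ + M / u := by
  have hq : 0 ≤ M / u := div_nonneg hM0 hu.le
  rw [abs_le]
  refine ⟨by linarith [h.le_slope u hu], ?_⟩
  rcases le_or_gt u 1 with h1 | h1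
  · linarith [h.slope_le hM hM0 ⟨hu, h1⟩]
  · rw [h.slope_tail u (h.length_le.trans_lt h1)]
    linarith

/-- One `θ` controls both terms: `θ ≤ θ↑` bounds the jump, and `θ y ≤ I y + L` bounds the positive
slope mass. -/
theorem exists_bound_of_cost_le {I : ℝ → ℝ≥0∞} (hI : ∃ θ : ℝ, 0 < θ ∧ cgf I θ < ⊤)
    {K : ℝ≥0∞} (hK : K ≠ ⊤) :
    ∃ M : ℝ, 0 ≤ M ∧ ∀ a y, 0 ≤ a → profileCost I a y ≤ K →
      a ≤ M ∧ ∫⁻ u in Ioc (0 : ℝ) 1, ENNReal.ofReal (y u) ≤ ENNReal.ofReal M := by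
  obtain ⟨θ, hθ, hcgf⟩ := hI
  obtain ⟨L, hL, hle⟩ := exists_le_of_cgf_lt_top hcgf
  have hup : ENNReal.ofReal θ ≤ thetaUp I :=
    le_iSup₂ (f := fun θ (_ : 0 < θ ∧ cgf I θ < ⊤) => ENNReal.ofReal θ) θ ⟨hθ, hcgf⟩
  have hM0 : 0 ≤ (K.toReal + L) / θ := by positivity
  refine ⟨(K.toReal + L) / θ, hM0, fun a y ha hcost => ⟨?_, ?_⟩⟩
  · have h1 : ENNReal.ofReal θ * ENNReal.ofReal a ≤ ENNReal.ofReal K.toReal := by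
      rw [ENNReal.ofReal_toReal hK]
      exact (mul_le_mul_left hup _).trans (le_self_add.trans hcost)
    rw [← ENNReal.ofReal_mul hθ.le, ENNReal.ofReal_le_ofReal_iff ENNReal.toReal_nonneg] at h1
    rw [le_div_iff₀ hθ]
    linarith
  · have h1 : ∫⁻ u in Ioc (0 : ℝ) 1, ENNReal.ofReal (θ * y u) ≤ K + ENNReal.ofReal L := by
      calc ∫⁻ u in Ioc (0 : ℝ) 1, ENNReal.ofReal (θ * y u)
          ≤ ∫⁻ u in Ioc (0 : ℝ) 1, (I (y u) + ENNReal.ofReal L) := lintegral_mono fun u => hle _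
        _ = (∫⁻ u in Ioc (0 : ℝ) 1, I (y u)) + ENNReal.ofReal L := by
            rw [lintegral_add_right _ measurable_const]
            simp
        _ ≤ K + ENNReal.ofReal L := by
            gcongr
            exact le_add_self.trans hcost
    simp_rw [ENNReal.ofReal_mul hθ.le] at h1
    rw [lintegral_const_mul' _ _ ENNReal.ofReal_ne_top] at h1
    rw [ENNReal.ofReal_div_of_pos hθ, ENNReal.ofReal_add ENNReal.toReal_nonneg hL,
      ENNReal.ofReal_toReal hK, ENNReal.le_div_iff_mul_le (Or.inl (by simpa using hθ))
        (Or.inl ENNReal.ofReal_ne_top), mul_comm]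
    exact h1

end IsProfile

/-- A sequence of profiles with uniformly bounded masses whose lengths, final values and slopes
converge. -/
structure ProfilesTendsto (δ M : ℝ) (ℓn an : ℕ → ℝ) (yn : ℕ → ℝ → ℝ) (ℓ p : ℝ) (y : ℝ → ℝ)
    (C : Set ℝ) : Prop where
  isProfile : ∀ n, IsProfile δ (ℓn n) (an n) (yn n)
  start_le : ∀ n, an n ≤ M
  mass_le : ∀ n, ∫⁻ u in Ioc (0 : ℝ) 1, ENNReal.ofReal (yn n u) ≤ ENNReal.ofReal M
  length : Tendsto ℓn atTop (𝓝 ℓ)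
  -- Profiles are pinned at time `1`, since mass escaping to `0` may keep the initial values from
  -- converging to that of the limit.
  final : Tendsto (fun n => profile (an n) (yn n) 1) atTop (𝓝 p)
  antitoneOn : AntitoneOn y (Ioi 0)
  countable : C.Countable
  slope : ∀ u ∉ C, 0 < u → Tendsto (fun n => yn n u) atTop (𝓝 (y u))

namespace ProfilesTendsto

variable {δ M : ℝ} {ℓn an : ℕ → ℝ} {yn : ℕ → ℝ → ℝ} {ℓ p : ℝ} {y : ℝ → ℝ} {C : Set ℝ}

theorem bound_nonneg (h : ProfilesTendsto δ M ℓn an yn ℓ p y C) : 0 ≤ M :=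
  (h.isProfile 0).start_nonneg.trans (h.start_le 0)

theorem length_le (h : ProfilesTendsto δ M ℓn an yn ℓ p y C) : ℓ ≤ 1 :=
  le_of_tendsto' h.length fun n => (h.isProfile n).length_le

theorem length_nonneg (h : ProfilesTendsto δ M ℓn an yn ℓ p y C) : 0 ≤ ℓ :=
  ge_of_tendsto' h.length fun n => (h.isProfile n).length_pos.le

theorem exists_between (h : ProfilesTendsto δ M ℓn an yn ℓ p y C) {u v : ℝ} (huv : u < v) :
    ∃ x ∉ C, u < x ∧ x < v := by
  obtain ⟨x, hx, hx'⟩ := (h.countable.dense_compl ℝ).exists_between huv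
  exact ⟨x, hx, hx'.1, hx'.2⟩

theorem le_slope (h : ProfilesTendsto δ M ℓn an yn ℓ p y C) {u : ℝ} (hu : 0 < u) : -δ ≤ y u := by
  obtain ⟨x, hx, hux, -⟩ := h.exists_between (lt_add_one u)
  refine le_trans ?_ (h.antitoneOn hu (hu.trans hux) hux.le)
  exact ge_of_tendsto' (h.slope x hx (hu.trans hux)) fun n =>
    (h.isProfile n).le_slope x (hu.trans hux)

theorem slope_tail (h : ProfilesTendsto δ M ℓn an yn ℓ p y C) {u : ℝ} (hu : ℓ < u) :
    y u = -δ := by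
  have h0 := h.length_nonneg
  refine le_antisymm ?_ (h.le_slope (h0.trans_lt hu))
  obtain ⟨x, hx, hℓx, hxu⟩ := h.exists_between hu
  refine (h.antitoneOn (h0.trans_lt hℓx) (h0.trans_lt hu) hxu.le).trans ?_
  refine le_of_tendsto (h.slope x hx (h0.trans_lt hℓx)) ?_
  filter_upwards [h.length.eventually (gt_mem_nhds hℓx)] with n hn
  exact ((h.isProfile n).slope_tail x hn).le

theorem ae_slope (h : ProfilesTendsto δ M ℓn an yn ℓ p y C) {s : Set ℝ} (hsm : MeasurableSet s)
    (hs : s ⊆ Ioi 0) :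
    ∀ᵐ u ∂(volume.restrict s), Tendsto (fun n => yn n u) atTop (𝓝 (y u)) := by
  rw [ae_restrict_iff' hsm]
  filter_upwards [h.countable.ae_notMem volume] with u hu hus using h.slope u hu (hs hus)

theorem aemeasurable (h : ProfilesTendsto δ M ℓn an yn ℓ p y C) :
    AEMeasurable y (volume.restrict (Ioc 0 1)) :=
  aemeasurable_restrict_of_antitoneOn measurableSet_Ioc
    (h.antitoneOn.mono fun _ hu => hu.1)

theorem aemeasurable_seq (h : ProfilesTendsto δ M ℓn an yn ℓ p y C) (n : ℕ) :
    AEMeasurable (yn n) (volume.restrict (Ioc 0 1)) :=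
  aemeasurable_restrict_of_antitoneOn measurableSet_Ioc
    ((h.isProfile n).antitoneOn.mono fun _ hu => hu.1)

theorem integrableOn (h : ProfilesTendsto δ M ℓn an yn ℓ p y C) :
    IntegrableOn y (Ioc 0 1) := by
  have hfatou : ∫⁻ u in Ioc (0 : ℝ) 1, ENNReal.ofReal (y u) ≤ ENNReal.ofReal M := by
    calc ∫⁻ u in Ioc (0 : ℝ) 1, ENNReal.ofReal (y u)
        ≤ ∫⁻ u in Ioc (0 : ℝ) 1, liminf (fun n => ENNReal.ofReal (yn n u)) atTop := by
          refine lintegral_mono_ae ?_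
          filter_upwards [h.ae_slope measurableSet_Ioc fun u hu => hu.1] with u hu
          exact ((ENNReal.continuous_ofReal.tendsto _).comp hu).liminf_eq.ge
      _ ≤ liminf (fun n => ∫⁻ u in Ioc (0 : ℝ) 1, ENNReal.ofReal (yn n u)) atTop :=
          lintegral_liminf_le' fun n => (h.aemeasurable_seq n).ennreal_ofReal
      _ ≤ ENNReal.ofReal M := by
          refine (liminf_le_liminf (Eventually.of_forall h.mass_le)).trans ?_
          simp
  refine ⟨h.aemeasurable.aestronglyMeasurable, ?_⟩
  rw [hasFiniteIntegral_iff_norm]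
  have hle : ∀ u ∈ Ioc (0 : ℝ) 1,
      ENNReal.ofReal ‖y u‖ ≤ ENNReal.ofReal (y u) + ENNReal.ofReal δ := by
    intro u hu
    have h1 := h.le_slope hu.1
    rcases le_total 0 (y u) with h0 | h0
    · rw [Real.norm_of_nonneg h0]
      exact le_self_add
    · rw [Real.norm_of_nonpos h0]
      exact (ENNReal.ofReal_le_ofReal (by linarith)).trans le_add_self
  refine (setLIntegral_mono' measurableSet_Ioc hle).trans_lt ?_
  rw [lintegral_add_right _ measurable_const]
  refine ENNReal.add_lt_top.2 ⟨hfatou.trans_lt ENNReal.ofReal_lt_top, ?_⟩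
  simp

theorem intervalIntegrable (h : ProfilesTendsto δ M ℓn an yn ℓ p y C) (R : ℝ)
    (hR : 0 ≤ R) : IntervalIntegrable y volume 0 R :=
  intervalIntegrable_of_tail h.length_le (fun _ hu => h.slope_tail hu) (h.integrableOn) R hR

theorem profile_limit_eq (h : ProfilesTendsto δ M ℓn an yn ℓ p y C) {t : ℝ}
    (ht : t ∈ Icc (0 : ℝ) 1) :
    profile (p - ∫ u in (0 : ℝ)..1, y u) y t = p - ∫ u in t..1, y u := by
  rw [profile, ← intervalIntegral.integral_add_adjacent_intervals
    (h.intervalIntegrable t ht.1)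
    ((h.intervalIntegrable t ht.1).symm.trans (h.intervalIntegrable 1 zero_le_one))]
  ring

/-- Integrating backwards from time `1`, the slopes are dominated by `δ + M / t`. This breaks down
at `t = 0`, which is excluded. -/
theorem tendsto_profile (h : ProfilesTendsto δ M ℓn an yn ℓ p y C) (hδ : 0 < δ) {t : ℝ}
    (ht : t ∈ Ioc (0 : ℝ) 1) :
    Tendsto (fun n => profile (an n) (yn n) t) atTop
      (𝓝 (profile (p - ∫ u in (0 : ℝ)..1, y u) y t)) := by
  have hM0 := h.bound_nonneg
  have hsub : Ioc t 1 ⊆ Ioc 0 1 := Ioc_subset_Ioc_left ht.1.le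
  have hdct : Tendsto (fun n => ∫ u in t..1, yn n u) atTop (𝓝 (∫ u in t..1, y u)) := by
    simp_rw [intervalIntegral.integral_of_le ht.2]
    refine tendsto_integral_of_dominated_convergence (fun _ => δ + M / t) (fun n =>
      ((h.aemeasurable_seq n).mono_set hsub).aestronglyMeasurable)
      (integrableOn_const (by simp)) (fun n => ?_)
      (h.ae_slope measurableSet_Ioc fun u hu => ht.1.trans hu.1)
    rw [ae_restrict_iff' measurableSet_Ioc]
    refine Eventually.of_forall fun u hu => ?_
    have h1 := (h.isProfile n).abs_slope_le hδ (h.mass_le n) hM0 (ht.1.trans hu.1)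
    have h2 : M / u ≤ M / t := div_le_div_of_nonneg_left hM0 ht.1 hu.1.le
    rw [Real.norm_eq_abs]
    linarith
  rw [h.profile_limit_eq ⟨ht.1.le, ht.2⟩]
  refine (h.final.sub hdct).congr fun n => ?_
  have hi := (h.isProfile n).integrable
  rw [profile, profile, ← intervalIntegral.integral_add_adjacent_intervals (hi t ht.1.le)
    ((hi t ht.1.le).symm.trans (hi 1 zero_le_one))]
  ring

theorem continuousOn (h : ProfilesTendsto δ M ℓn an yn ℓ p y C) (a : ℝ) :
    ContinuousOn (profile a y) (Icc 0 1) :=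
  continuousOn_profile (h.intervalIntegrable 1 zero_le_one)

theorem tendsto_profile_zero (h : ProfilesTendsto δ M ℓn an yn ℓ p y C) (a : ℝ) :
    Tendsto (profile a y) (𝓝[>] 0) (𝓝 a) := by
  have h0 : profile a y 0 = a := by simp [profile]
  have := (h.continuousOn a 0 ⟨le_rfl, zero_le_one⟩).mono (s := Ioc 0 1) Ioc_subset_Icc_self
  rw [ContinuousWithinAt, h0, nhdsWithin_Ioc_eq_nhdsGT zero_lt_one] at this
  exact this

theorem start_nonneg (h : ProfilesTendsto δ M ℓn an yn ℓ p y C) (hδ : 0 < δ) :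
    0 ≤ p - ∫ u in (0 : ℝ)..1, y u := by
  have h1 : Tendsto (fun t : ℝ => -δ * t) (𝓝[>] 0) (𝓝 0) := by
    have : Tendsto (fun t : ℝ => -δ * t) (𝓝 0) (𝓝 (-δ * 0)) := tendsto_id.const_mul _
    rw [mul_zero] at this
    exact this.mono_left nhdsWithin_le_nhds
  refine le_of_tendsto_of_tendsto h1 (h.tendsto_profile_zero _) ?_
  filter_upwards [Ioc_mem_nhdsGT zero_lt_one] with t ht
  exact ge_of_tendsto' (h.tendsto_profile hδ ht) fun n => (h.isProfile n).neg_le_profile ht.1.le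

theorem tendsto_area (h : ProfilesTendsto δ M ℓn an yn ℓ p y C) (hδ : 0 < δ) :
    Tendsto (fun n => profileArea (ℓn n) (an n) (yn n)) atTop
      (𝓝 (profileArea ℓ (p - ∫ u in (0 : ℝ)..1, y u) y)) := by
  have hM0 := h.bound_nonneg
  -- The varying length moves into an indicator, so that dominated convergence takes place on a
  -- fixed interval.
  have harea : ∀ l ∈ Icc (0 : ℝ) 1, ∀ f : ℝ → ℝ,
      ∫ t in (0 : ℝ)..l, f t = ∫ t in Ioc (0 : ℝ) 1, (Iic l).indicator f t := by
    intro l hl f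
    rw [intervalIntegral.integral_of_le hl.1, setIntegral_indicator measurableSet_Iic,
      Ioc_inter_Iic, min_eq_right hl.2]
  simp_rw [profileArea]
  rw [harea ℓ ⟨h.length_nonneg, h.length_le⟩]
  simp_rw [fun n => harea (ℓn n) ⟨(h.isProfile n).length_pos.le, (h.isProfile n).length_le⟩]
  refine tendsto_integral_of_dominated_convergence (fun _ => 2 * M) (fun n => ?_)
    (integrableOn_const (by simp)) (fun n => ?_) ?_
  · refine AEStronglyMeasurable.indicator ?_ measurableSet_Iic
    exact (((h.isProfile n).continuousOn.mono Ioc_subset_Icc_self).aestronglyMeasurable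
      measurableSet_Ioc)
  · rw [ae_restrict_iff' measurableSet_Ioc]
    refine Eventually.of_forall fun t ht => ?_
    by_cases htl : t ∈ Iic (ℓn n)
    · rw [indicator_of_mem htl, Real.norm_of_nonneg ((h.isProfile n).nonneg ⟨ht.1.le, htl⟩)]
      exact IsProfile.profile_le (h.start_le n) (h.mass_le n) hM0 ⟨ht.1.le, ht.2⟩
    · rw [indicator_of_notMem htl, norm_zero]
      linarith
  · have hne : ∀ᵐ t : ℝ, t ≠ ℓ := by simp [ae_iff]
    rw [ae_restrict_iff' measurableSet_Ioc]
    filter_upwards [hne] with t htℓ ht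
    rcases lt_or_gt_of_ne htℓ with hlt | hlt
    · rw [indicator_of_mem (show t ∈ Iic ℓ from hlt.le)]
      refine (h.tendsto_profile hδ ht).congr' ?_
      filter_upwards [h.length.eventually (lt_mem_nhds hlt)] with n hn
      rw [indicator_of_mem (show t ∈ Iic (ℓn n) from hn.le)]
    · rw [indicator_of_notMem (show t ∉ Iic ℓ from not_le.2 hlt)]
      refine tendsto_const_nhds.congr' ?_
      filter_upwards [h.length.eventually (gt_mem_nhds hlt)] with n hn
      rw [indicator_of_notMem (show t ∉ Iic (ℓn n) from not_le.2 hn)]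

theorem isProfile_limit (h : ProfilesTendsto δ M ℓn an yn ℓ p y C) (hδ : 0 < δ)
    (hℓ : 0 < ℓ) : IsProfile δ ℓ (p - ∫ u in (0 : ℝ)..1, y u) y where
  length_pos := hℓ
  length_le := h.length_le
  start_nonneg := h.start_nonneg hδ
  antitoneOn := h.antitoneOn
  le_slope := fun _ hu => h.le_slope hu
  slope_tail := fun _ hu => h.slope_tail hu
  integrable := h.intervalIntegrable
  end_nonneg := by
    have hc := (h.continuousOn (p - ∫ u in (0 : ℝ)..1, y u) ℓ ⟨hℓ.le, h.length_le⟩).mono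
      (s := Ico 0 ℓ) (fun t ht => ⟨ht.1, ht.2.le.trans h.length_le⟩)
    rw [ContinuousWithinAt, nhdsWithin_Ico_eq_nhdsLT hℓ] at hc
    refine ge_of_tendsto hc ?_
    filter_upwards [Ioo_mem_nhdsLT hℓ] with t ht
    refine ge_of_tendsto (h.tendsto_profile hδ ⟨ht.1, ht.2.le.trans h.length_le⟩) ?_
    filter_upwards [h.length.eventually (lt_mem_nhds ht.2)] with n hn
    exact (h.isProfile n).nonneg ⟨ht.1.le, hn.le⟩

/-- On `(0,t]` only the height reached is used: by the affine bound, jump and slopes together cost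
at least `θ` times the height at `t`, up to `L * t`. Heights converge for `t > 0`, and Fatou with
lower semicontinuity handles `(t,1]`. -/
theorem truncated_cost_le (h : ProfilesTendsto δ M ℓn an yn ℓ p y C) (hδ : 0 < δ)
    {I : ℝ → ℝ≥0∞} (hI : IsGoodConvexRate I) {θ L : ℝ} (hθ : 0 < θ) (hL : 0 ≤ L)
    (hle : ∀ y, ENNReal.ofReal (θ * y) ≤ I y + ENNReal.ofReal L)
    (hup : ENNReal.ofReal θ ≤ thetaUp I) {V : ℝ≥0∞}
    (hV : Tendsto (fun n => profileCost I (an n) (yn n)) atTop (𝓝 V)) {t : ℝ}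
    (ht : t ∈ Ioc (0 : ℝ) 1) :
    ENNReal.ofReal (θ * profile (p - ∫ u in (0 : ℝ)..1, y u) y t) + ∫⁻ u in Ioc t 1, I (y u)
      ≤ V + ENNReal.ofReal (L * t) := by
  have hsub : Ioc t 1 ⊆ Ioc 0 1 := Ioc_subset_Ioc_left ht.1.le
  have hfatou : ∫⁻ u in Ioc t 1, I (y u)
      ≤ liminf (fun n => ∫⁻ u in Ioc t 1, I (yn n u)) atTop := by
    calc ∫⁻ u in Ioc t 1, I (y u) ≤ ∫⁻ u in Ioc t 1, liminf (fun n => I (yn n u)) atTop := by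
          refine lintegral_mono_ae ?_
          filter_upwards [h.ae_slope (measurableSet_Ioc (a := t) (b := 1))
            fun u hu => ht.1.trans hu.1] with u hu
          exact (hI.lowerSemicontinuous.le_liminf (y u)).trans (liminf_le_liminf_of_le hu)
      _ ≤ _ := lintegral_liminf_le' fun n =>
          hI.measurable.comp_aemeasurable ((h.aemeasurable_seq n).mono_set hsub)
  have hu := (ENNReal.continuous_ofReal.tendsto _).comp ((h.tendsto_profile hδ ht).const_mul θ)
  refine add_le_of_tendsto_of_le_liminf hu hfatou (hV.add_const (ENNReal.ofReal (L * t))) fun n => ?_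
  simp only [Function.comp]
  have hsplit : ∫⁻ u in Ioc (0 : ℝ) 1, I (yn n u)
      = (∫⁻ u in Ioc 0 t, I (yn n u)) + ∫⁻ u in Ioc t 1, I (yn n u) := by
    rw [← Ioc_union_Ioc_eq_Ioc ht.1.le ht.2, lintegral_union measurableSet_Ioc]
    exact disjoint_left.2 fun u hu hu' => absurd hu'.1 (not_lt.2 hu.2)
  have hinit : ENNReal.ofReal (∫ u in (0 : ℝ)..t, θ * yn n u)
      ≤ (∫⁻ u in Ioc 0 t, I (yn n u)) + ENNReal.ofReal (L * t) := by
    refine (IsProfile.ofReal_integral_le ht.1.le).trans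
      ((lintegral_mono fun u => hle (yn n u)).trans ?_)
    rw [lintegral_add_right _ measurable_const]
    simp [ENNReal.ofReal_mul hL]
  have hprof : ENNReal.ofReal (θ * profile (an n) (yn n) t)
      ≤ ENNReal.ofReal θ * ENNReal.ofReal (an n)
        + ENNReal.ofReal (∫ u in (0 : ℝ)..t, θ * yn n u) := by
    rw [profile, mul_add, intervalIntegral.integral_const_mul, ← ENNReal.ofReal_mul hθ.le]
    exact ENNReal.ofReal_add_le
  rw [profileCost, hsplit]
  calc _ ≤ (thetaUp I * ENNReal.ofReal (an n) + ((∫⁻ u in Ioc 0 t, I (yn n u))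
        + ENNReal.ofReal (L * t))) + ∫⁻ u in Ioc t 1, I (yn n u) := by
        gcongr
        exact hprof.trans (add_le_add (mul_le_mul_left hup _) hinit)
    _ = _ := by ring

/-- In the truncated bound let `t → 0` for fixed `θ`, then take the supremum over `θ`, which charges
the initial jump at the full rate `θ↑`. -/
theorem cost_le (h : ProfilesTendsto δ M ℓn an yn ℓ p y C) (hδ : 0 < δ)
    {I : ℝ → ℝ≥0∞} (hI : IsGoodConvexRate I) (hup : ∃ θ : ℝ, 0 < θ ∧ cgf I θ < ⊤) {V : ℝ≥0∞}
    (hVtop : V ≠ ⊤) (hV : Tendsto (fun n => profileCost I (an n) (yn n)) atTop (𝓝 V)) :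
    profileCost I (p - ∫ u in (0 : ℝ)..1, y u) y ≤ V := by
  set a := p - ∫ u in (0 : ℝ)..1, y u with ha
  set X := ∫⁻ u in Ioc (0 : ℝ) 1, I (y u) with hX
  have key : ∀ θ : ℝ, 0 < θ → cgf I θ < ⊤ → ENNReal.ofReal θ * ENNReal.ofReal a + X ≤ V := by
    intro θ hθ hcgf
    obtain ⟨L, hL, hle⟩ := exists_le_of_cgf_lt_top hcgf
    have hθup : ENNReal.ofReal θ ≤ thetaUp I :=
      le_iSup₂ (f := fun θ (_ : 0 < θ ∧ cgf I θ < ⊤) => ENNReal.ofReal θ) θ ⟨hθ, hcgf⟩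
    set ε : ℕ → ℝ := fun n => 1 / ((n : ℝ) + 1) with hε
    have hε0 : ∀ n, 0 < ε n := fun n => by positivity
    have hε1 : ∀ n, ε n ∈ Ioc (0 : ℝ) 1 := fun n => ⟨hε0 n, by
      rw [hε]
      simp only
      rw [div_le_one (by positivity)]
      have : (0 : ℝ) ≤ n := Nat.cast_nonneg n
      linarith⟩
    have hεt : Tendsto ε atTop (𝓝 0) := tendsto_one_div_add_atTop_nhds_zero_nat
    have hεt' : Tendsto ε atTop (𝓝[>] 0) :=
      tendsto_nhdsWithin_iff.2 ⟨hεt, Eventually.of_forall hε0⟩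
    have t1 : Tendsto (fun n => ENNReal.ofReal (θ * profile a y (ε n))) atTop
        (𝓝 (ENNReal.ofReal (θ * a))) :=
      (ENNReal.continuous_ofReal.tendsto _).comp
        (((h.tendsto_profile_zero a).comp hεt').const_mul θ)
    have t2 : Tendsto (fun n => ∫⁻ u in Ioc (ε n) 1, I (y u)) atTop (𝓝 X) := by
      have hU : ⋃ n, Ioc (ε n) 1 = Ioc (0 : ℝ) 1 := by
        ext u
        simp only [mem_iUnion, mem_Ioc]
        refine ⟨fun ⟨n, h1, h2⟩ => ⟨(hε0 n).trans h1, h2⟩, fun hu => ?_⟩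
        obtain ⟨n, hn⟩ := exists_nat_one_div_lt hu.1
        exact ⟨n, hn, hu.2⟩
      have hmono : Monotone fun n => Ioc (ε n) (1 : ℝ) := fun m n hmn =>
        Ioc_subset_Ioc_left (by
          have : (m : ℝ) ≤ n := by exact_mod_cast hmn
          simp only [hε]
          gcongr)
      have := tendsto_measure_iUnion_atTop (μ := volume.withDensity fun u => I (y u)) hmono
      rw [hU, withDensity_apply _ measurableSet_Ioc] at this
      refine this.congr fun n => ?_
      simp only [Function.comp]
      rw [withDensity_apply _ measurableSet_Ioc]
    have t3 : Tendsto (fun n => V + ENNReal.ofReal (L * ε n)) atTop (𝓝 V) := by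
      have := ((ENNReal.continuous_ofReal.tendsto _).comp (hεt.const_mul L)).const_add V
      simpa using this
    rw [← ENNReal.ofReal_mul hθ.le]
    exact le_of_tendsto_of_tendsto' (t1.add t2) t3 fun n =>
      h.truncated_cost_le hδ hI hθ hL hle hθup hV (hε1 n)
  obtain ⟨θ₀, hθ₀, hcgf₀⟩ := hup
  have hXV : X ≤ V := le_add_self.trans (key θ₀ hθ₀ hcgf₀)
  have hXtop : X ≠ ⊤ := ne_top_of_le_ne_top hVtop hXV
  have hsup : thetaUp I * ENNReal.ofReal a ≤ V - X := by
    simp_rw [thetaUp, ENNReal.iSup_mul]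
    exact iSup₂_le fun θ hθ => ENNReal.le_sub_of_add_le_right hXtop (key θ hθ.1 hθ.2)
  rw [profileCost]
  calc thetaUp I * ENNReal.ofReal a + X ≤ (V - X) + X := by gcongr
    _ = V := tsub_add_cancel_of_le hXV

end ProfilesTendsto

/-! ### Optimal profiles and optimal paths -/

theorem exists_optimal_profile {I : ℝ → ℝ≥0∞} (hI : IsGoodConvexRate I) {δ : ℝ} (hδ : 0 < δ)
    (hup : ∃ θ : ℝ, 0 < θ ∧ cgf I θ < ⊤) {z : ℝ} (hz : 0 < z)
    (hex : ∃ ℓ a y, IsProfile δ ℓ a y ∧ z ≤ profileArea ℓ a y ∧ profileCost I a y < ⊤) :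
    ∃ ℓ a y, IsProfile δ ℓ a y ∧ z ≤ profileArea ℓ a y ∧
      ∀ ℓ' a' y', IsProfile δ ℓ' a' y' → z ≤ profileArea ℓ' a' y' →
        profileCost I a y ≤ profileCost I a' y' := by
  -- Only finite costs are admitted, so the first cost of the decreasing minimizing sequence bounds
  -- all the others.
  set 𝒮 : Set ℝ≥0∞ := {c | c < ⊤ ∧ ∃ ℓ a y, IsProfile δ ℓ a y ∧ z ≤ profileArea ℓ a y ∧
    profileCost I a y = c}
  obtain ⟨ℓ₀, a₀, y₀, hp₀, hz₀, hc₀⟩ := hex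
  obtain ⟨c, hcanti, hclim, hcmem⟩ := exists_seq_tendsto_sInf (S := 𝒮)
    ⟨_, hc₀, ℓ₀, a₀, y₀, hp₀, hz₀, rfl⟩ (OrderBot.bddBelow _)
  choose hctop ℓn an yn hpn hzn hcn using hcmem
  obtain ⟨M, hM0, hM⟩ := IsProfile.exists_bound_of_cost_le hup (hctop 0).ne
  have hMn : ∀ n, an n ≤ M ∧ ∫⁻ u in Ioc (0 : ℝ) 1, ENNReal.ofReal (yn n u) ≤ ENNReal.ofReal M :=
    fun n => hM _ _ (hpn n).start_nonneg ((hcn n).le.trans (hcanti (Nat.zero_le n)))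
  have hcomp : IsCompact (Icc (0 : ℝ) 1 ×ˢ Icc (-δ) (2 * M)) := isCompact_Icc.prod isCompact_Icc
  obtain ⟨⟨ℓ, p⟩, -, φ, hφ, hlim⟩ := hcomp.tendsto_subseq
    (x := fun n => (ℓn n, profile (an n) (yn n) 1)) fun n =>
      ⟨⟨(hpn n).length_pos.le, (hpn n).length_le⟩, by
        have := (hpn n).neg_le_profile zero_le_one
        rwa [mul_one] at this,
        IsProfile.profile_le (hMn n).1 (hMn n).2 hM0 ⟨zero_le_one, le_rfl⟩⟩
  obtain ⟨y, hy, χ, hχ, C, hC, hyC⟩ := exists_subseq_tendsto_antitoneOn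
    (f := fun n => yn (φ n)) (fun n => (hpn _).antitoneOn) (B := fun u => δ + M / u)
    (fun n u hu => (hpn _).abs_slope_le hδ (hMn _).2 hM0 hu)
  have hlim' := hlim.comp hχ.tendsto_atTop
  have hφχ : Tendsto (fun n => φ (χ n)) atTop atTop :=
    hφ.tendsto_atTop.comp hχ.tendsto_atTop
  have H : ProfilesTendsto δ M (fun n => ℓn (φ (χ n))) (fun n => an (φ (χ n)))
      (fun n => yn (φ (χ n))) ℓ p y C :=
    { isProfile := fun n => hpn _
      start_le := fun n => (hMn _).1
      mass_le := fun n => (hMn _).2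
      length := (continuous_fst.tendsto _).comp hlim'
      final := (continuous_snd.tendsto _).comp hlim'
      antitoneOn := hy
      countable := hC
      slope := hyC }
  have harea : z ≤ profileArea ℓ (p - ∫ u in (0 : ℝ)..1, y u) y :=
    ge_of_tendsto' (H.tendsto_area hδ) fun n => hzn _
  have hℓ : 0 < ℓ := by
    refine lt_of_le_of_ne H.length_nonneg fun h0 => ?_
    rw [← h0, profileArea, intervalIntegral.integral_same] at harea
    exact absurd hz (not_lt.2 harea)
  refine ⟨ℓ, _, y, H.isProfile_limit hδ hℓ, harea, fun ℓ' a' y' hp' hz' => ?_⟩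
  have hVtop : sInf 𝒮 ≠ ⊤ := ((sInf_le (show c 0 ∈ 𝒮 from
    ⟨hctop 0, _, _, _, hpn 0, hzn 0, hcn 0⟩)).trans_lt (hctop 0)).ne
  have hcost := H.cost_le hδ hI hup hVtop
    ((hclim.comp hφχ).congr fun n => (hcn _).symm)
  rcases eq_or_ne (profileCost I a' y') ⊤ with htop | htop
  · rw [htop]
    exact le_top
  · exact hcost.trans (sInf_le ⟨htop.lt_top, ℓ', a', y', hp', hz', rfl⟩)

namespace IsProfile

variable {δ ℓ a z : ℝ} {y : ℝ → ℝ} {I : ℝ → ℝ≥0∞}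

/-- The scale `c` is chosen so that `c²` times the area equals `z`. -/
theorem exists_feasible (h : IsProfile δ ℓ a y) (hδ : 0 < δ) (hIδ : I (-δ) = 0) (hz : 0 < z)
    (hza : z ≤ profileArea ℓ a y) :
    ∃ ψ, Feasible z ψ ∧
      J I ψ ≤ ENNReal.ofReal (√(z / profileArea ℓ a y)) * profileCost I a y := by
  have ha : 0 < profileArea ℓ a y := hz.trans_le hza
  have hr : 0 < z / profileArea ℓ a y := div_pos hz ha
  have hc : 0 < √(z / profileArea ℓ a y) := Real.sqrt_pos.2 hr
  have hc1 : √(z / profileArea ℓ a y) ≤ 1 := Real.sqrt_le_one.2 ((div_le_one ha).2 hza)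
  obtain ⟨ψ, hψ, hJ⟩ := (h.scale hc hc1).exists_path hδ hIδ
  rw [profileArea_scale hc.ne', Real.sq_sqrt hr.le, div_mul_cancel₀ _ ha.ne'] at hψ
  rw [h.profileCost_scale hIδ hc hc1] at hJ
  exact ⟨ψ, hψ, hJ⟩

theorem exists_feasible_le (h : IsProfile δ ℓ a y) (hδ : 0 < δ) (hIδ : I (-δ) = 0) (hz : 0 < z)
    (hza : z ≤ profileArea ℓ a y) : ∃ ψ, Feasible z ψ ∧ J I ψ ≤ profileCost I a y := by
  obtain ⟨ψ, hψ, hJ⟩ := h.exists_feasible hδ hIδ hz hza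
  refine ⟨ψ, hψ, hJ.trans (mul_le_of_le_one_left zero_le ?_)⟩
  rw [ENNReal.ofReal_le_one, Real.sqrt_le_one]
  exact (div_le_one (hz.trans_le hza)).2 hza

theorem exists_feasible_lt (h : IsProfile δ ℓ a y) (hδ : 0 < δ) (hIδ : I (-δ) = 0) (hz : 0 < z)
    (hza : z < profileArea ℓ a y) (hpos : 0 < profileCost I a y)
    (htop : profileCost I a y ≠ ⊤) : ∃ ψ, Feasible z ψ ∧ J I ψ < profileCost I a y := by
  obtain ⟨ψ, hψ, hJ⟩ := h.exists_feasible hδ hIδ hz hza.le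
  refine ⟨ψ, hψ, hJ.trans_lt ?_⟩
  have ha : 0 < profileArea ℓ a y := hz.trans hza
  have hlt : ENNReal.ofReal √(z / profileArea ℓ a y) < 1 := by
    rw [ENNReal.ofReal_lt_one, Real.sqrt_lt' one_pos, one_pow]
    exact (div_lt_one ha).2 hza
  calc _ < 1 * profileCost I a y := ENNReal.mul_lt_mul_left hpos.ne' htop hlt
    _ = _ := one_mul _

end IsProfile

theorem isPath_const {c : ℝ} (hc : 0 ≤ c) : IsPath fun _ => c where
  nonneg := fun _ _ => hc
  right_continuous := fun _ _ => continuousWithinAt_const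
  left_limit := fun _ _ => ⟨c, tendsto_const_nhds⟩
  finite_variation := by
    rw [BoundedVariationOn, eVariationOn.constant_on]
    · exact ENNReal.zero_ne_top
    · rintro _ ⟨_, _, rfl⟩ _ ⟨_, _, rfl⟩
      rfl

end RRW

/-! ### Existence and structure of optimal paths -/

theorem theorem2 (I : ℝ → ℝ≥0∞) (hI : RRW.IsGoodConvexRate I)
    (δ : ℝ) (hδ : 0 < δ) (hIδ : I (-δ) = 0) (hpos : ∀ y : ℝ, 0 < y → 0 < I y)
    (z : ℝ) (hz : 0 < z) :
    (∃ ψ : ℝ → ℝ, RRW.IsOptimal I z ψ) ∧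
    ∀ ψ : ℝ → ℝ, RRW.IsOptimal I z ψ → RRW.J I ψ < ⊤ →
      ∃ T₀ T₁ : ℝ, 0 ≤ T₀ ∧ T₀ < T₁ ∧ T₁ ≤ 1 ∧
        (∀ t ∈ Ioo T₀ T₁, 0 < ψ t) ∧
        (∀ t ∈ Icc (0 : ℝ) 1 \ Icc T₀ T₁, ψ t = 0) ∧
        ConcaveOn ℝ (Icc T₀ T₁) ψ ∧
        (∀ t ∈ Ioc T₀ T₁, ContinuousWithinAt ψ (Icc 0 1) t) := by
  have hup := hI.exists_cgf_lt_top hδ hIδ hpos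
  have hdown := hI.exists_cgf_neg_lt_top hδ hIδ
  constructor
  · by_cases hfin : ∃ φ, RRW.Feasible z φ ∧ RRW.J I φ < ⊤
    · obtain ⟨φ, ⟨hφ, hφz⟩, hφJ⟩ := hfin
      have hmaj : ∀ φ, RRW.Feasible z φ → ∃ ℓ a y, RRW.IsProfile δ ℓ a y ∧
          z ≤ RRW.profileArea ℓ a y ∧ RRW.profileCost I a y ≤ RRW.J I φ := by
        rintro φ ⟨hφ, hφz⟩
        obtain ⟨y, hy, hcost, hmaj⟩ := hφ.exists_profile hI.measurable hδ hIδ (hφz.symm ▸ hz)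
        exact ⟨_, _, y, hy, hφz ▸ (hφ.integral_le_profileArea (hφz.symm ▸ hz) hy hmaj).1,
          le_self_add.trans hcost⟩
      obtain ⟨ℓ₀, a₀, y₀, h₀, hz₀, hc₀⟩ := hmaj φ ⟨hφ, hφz⟩
      obtain ⟨ℓ, a, y, h, hza, hmin⟩ := RRW.exists_optimal_profile hI hδ hup hz
        ⟨ℓ₀, a₀, y₀, h₀, hz₀, hc₀.trans_lt hφJ⟩
      obtain ⟨ψ, hψ, hJ⟩ := h.exists_feasible_le hδ hIδ hz hza
      refine ⟨ψ, hψ, fun χ hχ => ?_⟩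
      obtain ⟨ℓ', a', y', h', hz', hc'⟩ := hmaj χ hχ
      exact hJ.trans ((hmin ℓ' a' y' h' hz').trans hc')
    -- If all feasible paths have infinite cost, each is optimal, for instance the constant `z`.
    · push Not at hfin
      exact ⟨fun _ => z, ⟨RRW.isPath_const hz.le, by simp⟩, fun φ hφ => le_top.trans (hfin φ hφ)⟩
  · rintro ψ ⟨⟨hψ, hψz⟩, hopt⟩ hJ
    have hz' : 0 < ∫ s in (0 : ℝ)..1, ψ s := hψz.symm ▸ hz
    obtain ⟨y, hy, hcost, hmaj⟩ := hψ.exists_profile hI.measurable hδ hIδ hz'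
    obtain ⟨hle, heq⟩ := hψ.integral_le_profileArea hz' hy hmaj
    rw [hψz] at hle heq
    have hcle := le_self_add.trans hcost
    have hctop := (hcle.trans_lt hJ).ne
    -- Excess area could be scaled away at a strictly smaller cost.
    have harea : z = RRW.profileArea (volume.real (RRW.busy ψ)) (RRW.singUp ψ).toReal y := by
      refine hle.eq_of_not_lt fun hlt => ?_
      obtain ⟨χ, hχ, hχJ⟩ := hy.exists_feasible_lt hδ hIδ hz hlt
        (hy.profileCost_pos hI.measurable hpos (RRW.thetaUp_pos hup) (hz.trans hlt)) hctop
      exact absurd ((hopt χ hχ).trans_lt (hχJ.trans_le hcle)) (lt_irrefl _)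
    -- The path built from the profile avoids the downward term; optimality cancels the finite
    -- profile cost and leaves `θ↓ * singDown ψ = 0`.
    have hsing : RRW.singDown ψ = 0 := by
      obtain ⟨χ, hχ, hχJ⟩ := hy.exists_feasible_le hδ hIδ hz harea.le
      have h1 : RRW.profileCost I (RRW.singUp ψ).toReal y + RRW.thetaDown I * RRW.singDown ψ
          ≤ RRW.profileCost I (RRW.singUp ψ).toReal y + 0 := by
        rw [add_zero]
        exact hcost.trans ((hopt χ hχ).trans hχJ)
      have h2 := (ENNReal.add_le_add_iff_left hctop).1 h1
      rw [nonpos_iff_eq_zero, mul_eq_zero] at h2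
      exact h2.resolve_left (RRW.thetaDown_pos hdown).ne'
    exact hψ.structure_of_eq hy hmaj (heq harea) hsing
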